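/- Let $D\ge 1$ and let $B_1,\dots,B_D$ be blocks, where $B_d$ is a list of $\mathrm{len}(B_d)\ge 1$ resonators, the $k$-th of which has wave speed $v_k(B_d)>0$, length $\ell_k(B_d)>0$ and spacing $s_k(B_d)>0$ to the next resonator on its right. A block sequence $\chi\in\{1,\dots,D\}^{\mathbb Z}$ defines bi-infinite sequences $(v_i)$, $(\ell_i)$, $(s_i)$, $i\in\mathbb Z$, by concatenating the blocks $\dots,B_{\chi(-1)},B_{\chi(0)},B_{\chi(1)},\dots$, where $i=0$ is the first resonator of $B_{\chi(0)}$. Let $\mathcal J(\chi)$ be the bounded Jacobi operator on the complex Hilbert space $\ell^2(\mathbb Z)$ given by $$(\mathcal J(\chi)x)^{(i)}=a_{i-1}x^{(i-1)}+a_i x^{(i+1)}+b_i x^{(i)},\qquad a_i=-\frac{v_iv_{i+1}}{s_i\sqrt{\ell_i\ell_{i+1}}},\qquad b_i=\frac{v_i^2}{\ell_i}\Big(\frac1{s_{i-1}}+\frac1{s_i}\Big),$$ and denote its spectrum by $\sigma(\mathcal J(\chi))$. For $\lambda\ge 0$ the propagation matrix of a resonator with parameters $(v,\ell,s)$ is $$P^\lambda_{\ell,s,v}=\begin{pmatrix}1-s\frac{\ell}{v^2}\lambda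 & s\\ -\frac{\ell}{v^2}\lambda & 1\end{pmatrix}\in \mathrm{SL}(2,\mathbb R),$$ and the block propagation matrix $\mathcal P_d^\lambda$ is the product of the propagation matrices of the resonators of $B_d$ in the order in which they act, $\mathcal P_d^\lambda=P^\lambda_{(\mathrm{len}(B_d))}\cdots P^\lambda_{(2)}P^\lambda_{(1)}$, where $P^\lambda_{(k)}$ belongs to the $k$-th resonator of $B_d$. If $|\operatorname{tr}\mathcal P_d^\lambda|>2$ (that is, $\mathcal P_d^\lambda$ is hyperbolic), then its source and its sink in $\mathbb{RP}^1$ are its eigenspaces for the eigenvalues of modulus $<1$ and $>1$, respectively. A family of hyperbolic matrices satisfies the source-sink condition if all of its sinks lie in one connected component of $\mathbb{RP}^1$ minus the set of all of its sources. The sequence $\chi$ is pseudo-ergodic if every finite word over $\{1,\dots,D\}$ occurs in it as a block of consecutive entries. **Theorem.** Let $\chi$ be pseudo-ergodic and $\lambda\ge 0$. 1. If $|\operatorname{tr}\mathcal P_d^\lambda|>2$ for all $d=1,\dots,D$ and the family $\{\mathcal P_1^\lambda,\dots,\mathcal P_D^\lambda\}$ satisfies the source-sink condition, then $\lambda\notin\sigma(\mathcal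 J(\chi))$. 2. If $|\operatorname{tr}\mathcal P_d^\lambda|\le 2$ for some $d\in\{1,\dots,D\}$, then $\lambda\in\sigma(\mathcal J(\chi))$. -/

import Mathlib

noncomputable section

namespace BlockDisorder

open scoped Matrix LinearAlgebra.Projectivization

/-! ## Jacobi operators on the complex Hilbert space of square-summable bi-infinite sequences -/

/-- The Hilbert space of square-summable sequences of complex numbers indexed by the integers. -/
abbrev EllTwo : Type := lp (fun _ : ℤ => ℂ) 2

theorem rpow_weightedShift_le (c : ℤ → ℝ) (C : ℝ) (hc : ∀ i, |c i| ≤ C) (k : ℤ) (x : ℤ → ℂ)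
    (i : ℤ) : ‖(c i : ℂ) * x (i + k)‖ ^ (2 : ENNReal).toReal
      ≤ C ^ (2 : ENNReal).toReal * ‖x (i + k)‖ ^ (2 : ENNReal).toReal := by
  have hC : 0 ≤ C := (abs_nonneg _).trans (hc i)
  rw [← Real.mul_rpow hC (norm_nonneg _)]
  refine Real.rpow_le_rpow (norm_nonneg _) ?_ (by norm_num)
  rw [norm_mul, Complex.norm_real, Real.norm_eq_abs]
  exact mul_le_mul_of_nonneg_right (hc i) (norm_nonneg _)

theorem summable_shift (k : ℤ) (x : EllTwo) :
    Summable fun i : ℤ => ‖x (i + k)‖ ^ (2 : ENNReal).toReal := by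
  have hs : Summable fun i : ℤ => ‖x i‖ ^ (2 : ENNReal).toReal :=
    (lp.memℓp x).summable (by norm_num)
  exact hs.comp_injective (add_left_injective k)

theorem memlp_weightedShift (c : ℤ → ℝ) (C : ℝ) (hc : ∀ i, |c i| ≤ C) (k : ℤ) (x : EllTwo) :
    Memℓp (fun i : ℤ => (c i : ℂ) * x (i + k)) 2 :=
  memℓp_gen (Summable.of_nonneg_of_le (fun _ => Real.rpow_nonneg (norm_nonneg _) _)
    (rpow_weightedShift_le c C hc k x) ((summable_shift k x).mul_left _))

/-- For a bounded real sequence `c`, the bounded operator `(x i)_i ↦ (c i * x (i + k))_i`. -/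
def weightedShift (c : ℤ → ℝ) (hc : ∃ C, ∀ i, |c i| ≤ C) (k : ℤ) : EllTwo →L[ℂ] EllTwo :=
  LinearMap.mkContinuousOfExistsBound
    { toFun := fun x => ⟨fun i => (c i : ℂ) * x (i + k),
        memlp_weightedShift c hc.choose hc.choose_spec k x⟩
      map_add' := fun x y => by
        apply lp.ext
        funext i
        exact mul_add _ _ _
      map_smul' := fun r x => by
        apply lp.ext
        funext i
        exact mul_left_comm _ _ _ }
    (by
      obtain ⟨C, hC⟩ := hc
      have hC0 : 0 ≤ C := (abs_nonneg _).trans (hC 0)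
      refine ⟨C, fun x => ?_⟩
      refine lp.norm_le_of_tsum_le (by norm_num) (by positivity) ?_
      have hle := rpow_weightedShift_le c C hC k x
      have hm := (summable_shift k x).mul_left (C ^ (2 : ENNReal).toReal)
      rw [Real.mul_rpow hC0 (norm_nonneg _), lp.norm_rpow_eq_tsum (by norm_num) x]
      calc _ ≤ ∑' i : ℤ, C ^ (2 : ENNReal).toReal * ‖x (i + k)‖ ^ (2 : ENNReal).toReal :=
            Summable.tsum_le_tsum hle
              (Summable.of_nonneg_of_le (fun i => Real.rpow_nonneg (norm_nonneg _) _) hle hm) hm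
        _ = _ := by
          rw [tsum_mul_left]
          congr 1
          exact (Equiv.addRight k).tsum_eq (fun i => ‖x i‖ ^ (2 : ENNReal).toReal))

theorem weightedShift_apply (c : ℤ → ℝ) (hc : ∃ C, ∀ i, |c i| ≤ C) (k : ℤ) (x : EllTwo) (i : ℤ) :
    weightedShift c hc k x i = (c i : ℂ) * x (i + k) := rfl

/-- The Jacobi operator with bounded real off-diagonal `a` and bounded real diagonal `b`:
`(J x) i = a (i - 1) * x (i - 1) + a i * x (i + 1) + b i * x i`. -/
def jacobiOperator (a b : ℤ → ℝ) (ha : ∃ C, ∀ i, |a i| ≤ C) (hb : ∃ C, ∀ i, |b i| ≤ C) :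
    EllTwo →L[ℂ] EllTwo :=
  weightedShift (fun i => a (i - 1)) (ha.imp fun _ h i => h (i - 1)) (-1)
    + weightedShift a ha 1 + weightedShift b hb 0

theorem jacobiOperator_apply (a b : ℤ → ℝ) (ha : ∃ C, ∀ i, |a i| ≤ C)
    (hb : ∃ C, ∀ i, |b i| ≤ C) (x : EllTwo) (i : ℤ) :
    jacobiOperator a b ha hb x i
      = (a (i - 1) : ℂ) * x (i - 1) + (a i : ℂ) * x (i + 1) + (b i : ℂ) * x i := by
  simp [jacobiOperator, weightedShift_apply, sub_eq_add_neg]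

/-! ## Resonators, blocks and block sequences -/

/-- A resonator, given by its wave speed, its length, and the spacing that separates it from the
next resonator to its right. -/
structure Resonator where
  speed : ℝ
  length : ℝ
  spacing : ℝ
  speed_pos : 0 < speed
  length_pos : 0 < length
  spacing_pos : 0 < spacing

/-- A library of `D` blocks; the block `d` consists of `len d ≥ 1` resonators. -/
structure BlockLibrary (D : ℕ) where
  len : Fin D → ℕ
  len_pos : ∀ d, 0 < len d
  resonator : (d : Fin D) → Fin (len d) → Resonator

/-- A bi-infinite sequence over `{1, …, D}` is pseudo-ergodic if every finite word occurs in it. -/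
def IsPseudoErgodic {D : ℕ} (χ : ℤ → Fin D) : Prop :=
  ∀ (M : ℕ) (w : Fin M → Fin D), ∃ j : ℤ, ∀ k : Fin M, χ (j + (k : ℤ)) = w k

namespace BlockLibrary

variable {D : ℕ} (B : BlockLibrary D)

/-- The pairs `(d, r)`, standing for the `r`-th resonator of the block `d`. -/
abbrev Label : Type := (d : Fin D) × Fin (B.len d)

/-- The resonator slots of the array that the block sequence `χ` defines: the slot `(j, r)` is the
`r`-th resonator of the `j`-th block of the array. -/
abbrev Slot (χ : ℤ → Fin D) : Type := (j : ℤ) × Fin (B.len (χ j))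

/-- The slot directly to the right: the next one in the same block if there is one, and otherwise
the first one of the next block. -/
def nextSlot (χ : ℤ → Fin D) (p : B.Slot χ) : B.Slot χ :=
  if h : (p.2 : ℕ) + 1 < B.len (χ p.1) then ⟨p.1, ⟨(p.2 : ℕ) + 1, h⟩⟩
  else ⟨p.1 + 1, ⟨0, B.len_pos _⟩⟩

/-- The slot directly to the left. -/
def prevSlot (χ : ℤ → Fin D) (p : B.Slot χ) : B.Slot χ :=
  if 0 < (p.2 : ℕ) then ⟨p.1, ⟨(p.2 : ℕ) - 1, lt_of_le_of_lt (Nat.sub_le _ _) p.2.2⟩⟩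
  else ⟨p.1 - 1, ⟨B.len (χ (p.1 - 1)) - 1, Nat.sub_lt (B.len_pos _) one_pos⟩⟩

theorem slot_ext {χ : ℤ → Fin D} {p q : B.Slot χ} (h1 : p.1 = q.1)
    (h2 : (p.2 : ℕ) = (q.2 : ℕ)) : p = q := by
  obtain ⟨i, r⟩ := p
  obtain ⟨j, t⟩ := q
  obtain rfl : i = j := h1
  obtain rfl : r = t := Fin.ext h2
  rfl

/-- The step to the right, as a permutation of the slots. -/
def slotShift (χ : ℤ → Fin D) : Equiv.Perm (B.Slot χ) where
  toFun := B.nextSlot χ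
  invFun := B.prevSlot χ
  left_inv p := by
    have h2 := p.2.2
    by_cases h : (p.2 : ℕ) + 1 < B.len (χ p.1)
    · have e : B.nextSlot χ p = ⟨p.1, ⟨(p.2 : ℕ) + 1, h⟩⟩ := dif_pos h
      rw [e]
      exact if_pos (Nat.succ_pos _)
    · have e : B.nextSlot χ p = ⟨p.1 + 1, ⟨0, B.len_pos _⟩⟩ := dif_neg h
      rw [e]
      refine (if_neg (lt_irrefl 0)).trans (B.slot_ext (add_sub_cancel_right _ _) ?_)
      change B.len (χ (p.1 + 1 - 1)) - 1 = _
      rw [add_sub_cancel_right]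
      omega
  right_inv p := by
    have h2 := p.2.2
    by_cases h : 0 < (p.2 : ℕ)
    · have e : B.prevSlot χ p
          = ⟨p.1, ⟨(p.2 : ℕ) - 1, lt_of_le_of_lt (Nat.sub_le _ _) p.2.2⟩⟩ := if_pos h
      rw [e]
      have h3 : (p.2 : ℕ) - 1 + 1 < B.len (χ p.1) := by omega
      refine (dif_pos h3).trans (B.slot_ext rfl ?_)
      exact Nat.sub_add_cancel h
    · have e : B.prevSlot χ p
          = ⟨p.1 - 1, ⟨B.len (χ (p.1 - 1)) - 1, Nat.sub_lt (B.len_pos _) one_pos⟩⟩ := if_neg h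
      rw [e]
      have h3 : ¬ (B.len (χ (p.1 - 1)) - 1 + 1 < B.len (χ (p.1 - 1))) := by omega
      refine (dif_neg h3).trans (B.slot_ext (sub_add_cancel _ _) ?_)
      change 0 = (p.2 : ℕ)
      omega

/-- The slot of the `i`-th resonator of the array; the resonator with index `0` is the first one of
the block with index `0`. -/
def slotAt (χ : ℤ → Fin D) (i : ℤ) : B.Slot χ := (B.slotShift χ ^ i) ⟨0, ⟨0, B.len_pos _⟩⟩

/-- The label of the `i`-th resonator: this is the bi-infinite sequence
`…, (χ 0, first), …, (χ 0, last), (χ 1, first), …`. -/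
def labelAt (χ : ℤ → Fin D) (i : ℤ) : B.Label := ⟨χ (B.slotAt χ i).1, (B.slotAt χ i).2⟩

/-- The resonator with a given label. -/
def ofLabel (p : B.Label) : Resonator := B.resonator p.1 p.2

/-- The `i`-th resonator of the array. -/
def resonatorAt (χ : ℤ → Fin D) (i : ℤ) : Resonator := B.ofLabel (B.labelAt χ i)

/-- The off-diagonal entry `a i = - v i * v (i + 1) / (s i * √(ℓ i * ℓ (i + 1)))`. -/
def offDiag (χ : ℤ → Fin D) (i : ℤ) : ℝ :=
  -((B.resonatorAt χ i).speed * (B.resonatorAt χ (i + 1)).speed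
    / ((B.resonatorAt χ i).spacing
        * √((B.resonatorAt χ i).length * (B.resonatorAt χ (i + 1)).length)))

/-- The diagonal entry `b i = (v i) ^ 2 / ℓ i * (1 / s (i - 1) + 1 / s i)`. -/
def diag (χ : ℤ → Fin D) (i : ℤ) : ℝ :=
  (B.resonatorAt χ i).speed ^ 2 / (B.resonatorAt χ i).length
    * (1 / (B.resonatorAt χ (i - 1)).spacing + 1 / (B.resonatorAt χ i).spacing)

theorem bounded_of_labels (f : B.Label → B.Label → ℝ) (x y : ℤ → B.Label) :
    ∃ C, ∀ i : ℤ, |f (x i) (y i)| ≤ C := by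
  obtain ⟨C, hC⟩ := (Set.finite_range fun p : B.Label × B.Label => |f p.1 p.2|).bddAbove
  exact ⟨C, fun i => hC ⟨(x i, y i), rfl⟩⟩

theorem offDiag_bounded (χ : ℤ → Fin D) : ∃ C, ∀ i, |B.offDiag χ i| ≤ C :=
  B.bounded_of_labels (fun p q => -((B.ofLabel p).speed * (B.ofLabel q).speed
    / ((B.ofLabel p).spacing * √((B.ofLabel p).length * (B.ofLabel q).length))))
    (B.labelAt χ) (fun i => B.labelAt χ (i + 1))

theorem diag_bounded (χ : ℤ → Fin D) : ∃ C, ∀ i, |B.diag χ i| ≤ C :=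
  B.bounded_of_labels (fun p q => (B.ofLabel p).speed ^ 2 / (B.ofLabel p).length
    * (1 / (B.ofLabel q).spacing + 1 / (B.ofLabel p).spacing))
    (B.labelAt χ) (fun i => B.labelAt χ (i - 1))

/-- The Jacobi operator of the infinite block disordered system with block sequence `χ`. -/
def jacobi (χ : ℤ → Fin D) : EllTwo →L[ℂ] EllTwo :=
  jacobiOperator (B.offDiag χ) (B.diag χ) (B.offDiag_bounded χ) (B.diag_bounded χ)

end BlockLibrary

/-! ## Propagation matrices -/

/-- The propagation matrix of a single resonator at frequency `lam`. -/
def Resonator.propagation (R : Resonator) (lam : ℝ) : Matrix (Fin 2) (Fin 2) ℝ :=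
  !![1 - R.spacing * (R.length / R.speed ^ 2) * lam, R.spacing;
     -(R.length / R.speed ^ 2) * lam, 1]

/-- The block propagation matrix `P_len * ⋯ * P_2 * P_1`, which carries a state from the left end of
the block to its right end, so that the first resonator of the block acts first. -/
def BlockLibrary.blockPropagation {D : ℕ} (B : BlockLibrary D) (lam : ℝ) (d : Fin D) :
    Matrix (Fin 2) (Fin 2) ℝ :=
  (List.ofFn fun k : Fin (B.len d) => (B.resonator d k).propagation lam).reverse.prod

/-- A matrix (in practice in `SL(2, ℝ)`) is hyperbolic if its trace exceeds `2` in modulus. -/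
def IsHyperbolic (A : Matrix (Fin 2) (Fin 2) ℝ) : Prop := 2 < |A.trace|

/-! ## The real projective line and the source-sink condition -/

/-- The real projective line, as the set of lines through the origin of the plane. -/
abbrev RPOne : Type := ℙ ℝ (Fin 2 → ℝ)

/-- The quotient topology from the punctured plane. -/
instance instTopologicalSpaceRPOne : TopologicalSpace RPOne :=
  inferInstanceAs (TopologicalSpace (Quotient (projectivizationSetoid ℝ (Fin 2 → ℝ))))

/-- `p` is the eigenspace of `A` for an eigenvalue of modulus greater than one. -/
def IsSink (A : Matrix (Fin 2) (Fin 2) ℝ) (p : RPOne) : Prop :=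
  ∃ ξ : ℝ, 1 < |ξ| ∧ p.submodule = Module.End.eigenspace (Matrix.toLin' A) ξ

/-- `p` is the eigenspace of `A` for an eigenvalue of modulus less than one. -/
def IsSource (A : Matrix (Fin 2) (Fin 2) ℝ) (p : RPOne) : Prop :=
  ∃ ξ : ℝ, |ξ| < 1 ∧ p.submodule = Module.End.eigenspace (Matrix.toLin' A) ξ

/-- The source-sink condition for a family of hyperbolic matrices: no sink is a source, and any two
sinks lie in the same connected component of the complement of the set of all sources.
(The set `connectedComponentIn F p` is empty for `p ∉ F`.) -/
def SourceSinkCondition {ι : Type*} (A : ι → Matrix (Fin 2) (Fin 2) ℝ) : Prop :=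
  ∀ (d e : ι) (p q : RPOne), IsSink (A d) p → IsSink (A e) q →
    q ∈ connectedComponentIn {x : RPOne | ∃ c, IsSource (A c) x}ᶜ p

end BlockDisorder

end

open scoped Matrix LinearAlgebra.Projectivization

namespace BlockDisorder

/-! Put `ω i = v i / √(ℓ i)`, `u i = ω i * x i` and `p i = (u i - u (i - 1)) / s (i - 1)`. Then `(J
- λ) x = y` becomes the first-order recursion `w (i + 1) = P i w i + g i` for the states `w = (u,
p)`, where `P i` is the propagation matrix of the `i`-th resonator and `g i` is bounded by a
constant times `|y i|`.

Hyperbolic blocks: under the source-sink condition the sinks occupy an arc free of sources, so one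
quadratic form is positive on all sinks and negative on all sources. Such a form increases strictly
under every block matrix (`SourceSinkCondition.exists_quadraticForm`). Interpolated inside the
blocks, it becomes a Lyapunov function for the single resonators. Along a square-summable sequence
its increments sum to zero over the integers, which leaves a bound of `x` by `(J - λ) x`
(`exists_tsum_sq_le`). Since `J - λ` is self-adjoint, this lower bound makes it invertible.

A non-hyperbolic block: its matrix has a complex eigenvalue of modulus one, hence a Bloch solution
on repetitions of the block that stays bounded above and below. Pseudo-ergodicity supplies
arbitrarily long runs of that block. Cutting the solution off at the ends of a run leaves a residual
at no more than four sites, of bounded size, while the norm grows with the run. No bounded inverse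
of `J - λ` can exist (`mem_spectrum_of_windows`). -/

/-! ## Separating the sinks from the sources by a quadratic form -/

/-- The determinant of the pair `(v, w)` of plane vectors. -/
def cross (v w : Fin 2 → ℝ) : ℝ := v 0 * w 1 - v 1 * w 0

/-- Stated over any field because it serves twice: over the reals for sinks and sources, over the
complex numbers for Bloch solutions. -/
theorem exists_eigenvector_of_root {K : Type*} [Field K] {A : Matrix (Fin 2) (Fin 2) K}
    (hA : A.det = 1) {ξ : K} (hξ : ξ ^ 2 - A.trace * ξ + 1 = 0) :
    ∃ v : Fin 2 → K, v ≠ 0 ∧ A *ᵥ v = ξ • v := by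
  have hdet : (A - ξ • (1 : Matrix (Fin 2) (Fin 2) K)).det = 0 := by
    rw [Matrix.det_fin_two] at hA ⊢
    rw [Matrix.trace_fin_two] at hξ
    simp only [Matrix.sub_apply, Matrix.smul_apply, Matrix.one_apply_eq, smul_eq_mul, mul_one,
      Matrix.one_apply_ne (zero_ne_one : (0 : Fin 2) ≠ 1),
      Matrix.one_apply_ne (one_ne_zero : (1 : Fin 2) ≠ 0), mul_zero, sub_zero]
    linear_combination hξ + hA
  obtain ⟨v, hv, hv'⟩ := Matrix.exists_mulVec_eq_zero_iff.mpr hdet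
  refine ⟨v, hv, ?_⟩
  rw [Matrix.sub_mulVec, Matrix.smul_mulVec, Matrix.one_mulVec] at hv'
  exact sub_eq_zero.mp hv'

theorem exists_root_of_two_lt_abs {t : ℝ} (ht : 2 < |t|) :
    ∃ ξ : ℝ, 1 < |ξ| ∧ ξ ^ 2 - t * ξ + 1 = 0 := by
  have h4 : 0 ≤ t ^ 2 - 4 := by nlinarith [sq_abs t]
  have hs := Real.sq_sqrt h4
  have hs0 := Real.sqrt_nonneg (t ^ 2 - 4)
  rcases lt_abs.mp ht with h | h
  · refine ⟨(t + √(t ^ 2 - 4)) / 2, ?_, by linear_combination hs / 4⟩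
    exact lt_of_lt_of_le (by linarith) (le_abs_self _)
  · refine ⟨(t - √(t ^ 2 - 4)) / 2, ?_, by linear_combination hs / 4⟩
    exact lt_of_lt_of_le (by linarith) (neg_le_abs _)

/-- Cramer's rule in the plane. -/
theorem cross_smul_eq (q s v : Fin 2 → ℝ) :
    cross q s • v = cross v s • q + cross q v • s := by
  funext i
  fin_cases i <;> simp [cross] <;> ring

theorem exists_smul_of_cross_eq_zero {v w : Fin 2 → ℝ} (hw : w ≠ 0) (h : cross v w = 0) :
    ∃ c : ℝ, v = c • w := by
  simp only [cross] at h
  have hcase : w 0 ≠ 0 ∨ w 1 ≠ 0 := by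
    by_contra hcon
    push Not at hcon
    apply hw
    funext i
    fin_cases i
    · exact hcon.1
    · exact hcon.2
  rcases hcase with h0 | h0
  · refine ⟨v 0 / w 0, ?_⟩
    funext i
    fin_cases i
    · simp [h0]
    · simp only [Fin.mk_one, Pi.smul_apply, smul_eq_mul]
      field_simp
      linarith
  · refine ⟨v 1 / w 1, ?_⟩
    funext i
    fin_cases i
    · simp only [Fin.zero_eta, Pi.smul_apply, smul_eq_mul]
      field_simp
      linarith
    · simp [h0]

theorem cross_ne_zero_of_eigenvectors {A : Matrix (Fin 2) (Fin 2) ℝ} {ξ η : ℝ} (hne : ξ ≠ η)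
    {q s : Fin 2 → ℝ} (hq0 : q ≠ 0) (hs0 : s ≠ 0) (hq : A *ᵥ q = ξ • q) (hs : A *ᵥ s = η • s) :
    cross q s ≠ 0 := by
  intro h
  obtain ⟨c, rfl⟩ := exists_smul_of_cross_eq_zero hs0 h
  have hc : c ≠ 0 := fun hc => hq0 (by simp [hc])
  rw [Matrix.mulVec_smul, hs, smul_comm ξ c s] at hq
  exact hne (smul_left_injective ℝ hs0 (smul_right_injective _ hc hq)).symm

theorem eigenspace_eq_span {A : Matrix (Fin 2) (Fin 2) ℝ} {ξ η : ℝ} (hne : ξ ≠ η)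
    {q s : Fin 2 → ℝ} (hq0 : q ≠ 0) (hs0 : s ≠ 0) (hq : A *ᵥ q = ξ • q) (hs : A *ᵥ s = η • s) :
    Submodule.span ℝ {q} = Module.End.eigenspace (Matrix.toLin' A) ξ := by
  ext v
  rw [Submodule.mem_span_singleton, Module.End.mem_eigenspace_iff, Matrix.toLin'_apply]
  constructor
  · rintro ⟨c, rfl⟩
    rw [Matrix.mulVec_smul, hq, smul_comm]
  · intro hv
    have hcr : cross v q = 0 := by
      by_cases hv0 : v = 0
      · simp [hv0, cross]
      by_contra hcon
      -- This writes a multiple of `s` as a combination of `v` and `q`. Applying `A` scales one side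
      -- by `η` and the other by `ξ`, so that multiple must vanish.
      have hm := cross_smul_eq v q s
      have := congrArg (A *ᵥ ·) hm
      simp only [Matrix.mulVec_smul, Matrix.mulVec_add, hv, hq, hs] at this
      rw [smul_comm _ ξ v, smul_comm _ ξ q, ← smul_add, ← hm, smul_comm _ η s] at this
      exact hne (smul_left_injective ℝ (smul_ne_zero hcon hs0) this).symm
    obtain ⟨c, rfl⟩ := exists_smul_of_cross_eq_zero hq0 hcr
    exact ⟨c, rfl⟩

/-! ### Arcs of the projective line between two points. -/

theorem cross_mul_cross_div_smul (s s' v : Fin 2 → ℝ) {c : ℝ} (hc : c ≠ 0) :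
    cross (c • v) s * cross (c • v) s' / ((c • v) 0 ^ 2 + (c • v) 1 ^ 2)
      = cross v s * cross v s' / (v 0 ^ 2 + v 1 ^ 2) := by
  simp only [cross, Pi.smul_apply, smul_eq_mul]
  rw [← mul_div_mul_left _ (v 0 ^ 2 + v 1 ^ 2) (pow_ne_zero 2 hc)]
  congr 1 <;> ring

theorem sq_add_sq_ne_zero {v : Fin 2 → ℝ} (hv : v ≠ 0) : v 0 ^ 2 + v 1 ^ 2 ≠ 0 := by
  intro h
  apply hv
  have h0 : v 0 = 0 := (pow_eq_zero_iff two_ne_zero).mp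
    (by nlinarith [sq_nonneg (v 0), sq_nonneg (v 1)])
  have h1 : v 1 = 0 := (pow_eq_zero_iff two_ne_zero).mp
    (by nlinarith [sq_nonneg (v 0), sq_nonneg (v 1)])
  funext i
  fin_cases i
  · exact h0
  · exact h1

/-- A function on the projective line whose sign tells on which of the two arcs between the lines
through `s` and `s'` a point lies. -/
noncomputable def arcSign (s s' : Fin 2 → ℝ) : RPOne → ℝ :=
  Projectivization.lift
    (fun v => cross v.1 s * cross v.1 s' / (v.1 0 ^ 2 + v.1 1 ^ 2))
    (by
      rintro ⟨v, hv⟩ ⟨w, hw⟩ t (rfl : v = t • w)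
      have ht : t ≠ 0 := fun h => hv (by simp [h])
      exact cross_mul_cross_div_smul s s' w ht)

theorem arcSign_mk (s s' v : Fin 2 → ℝ) (hv : v ≠ 0) :
    arcSign s s' (Projectivization.mk ℝ v hv)
      = cross v s * cross v s' / (v 0 ^ 2 + v 1 ^ 2) := rfl

theorem continuous_arcSign (s s' : Fin 2 → ℝ) : Continuous (arcSign s s') := by
  refine Continuous.quotient_lift ?_ _
  simp only [cross]
  have hc : ∀ i, Continuous fun v : {v : Fin 2 → ℝ // v ≠ 0} => v.1 i := fun i =>
    (continuous_apply i).comp continuous_subtype_val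
  have h0 := hc 0
  have h1 := hc 1
  have hl : ∀ r : Fin 2 → ℝ, Continuous fun v : {v : Fin 2 → ℝ // v ≠ 0} =>
      v.1 0 * r 1 - v.1 1 * r 0 := fun r =>
    (h0.mul continuous_const).sub (h1.mul continuous_const)
  refine Continuous.div ((hl s).mul (hl s')) ((h0.pow 2).add (h1.pow 2)) ?_
  rintro ⟨v, hv⟩
  exact sq_add_sq_ne_zero hv

/-- Two lines in one component of a set that avoids the lines through `s` and `s'` lie on the same
arc between these lines. -/
theorem cross_pos_of_mem_connectedComponentIn {F : Set RPOne} {s s' p q : Fin 2 → ℝ}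
    (hs : s ≠ 0) (hs' : s' ≠ 0) (hp : p ≠ 0) (hq : q ≠ 0)
    (hsF : Projectivization.mk ℝ s hs ∉ F) (hsF' : Projectivization.mk ℝ s' hs' ∉ F)
    (h : Projectivization.mk ℝ q hq ∈ connectedComponentIn F (Projectivization.mk ℝ p hp)) :
    0 < (cross p s * cross p s') * (cross q s * cross q s') := by
  have hpF : Projectivization.mk ℝ p hp ∈ F := by
    by_contra hcon
    rw [connectedComponentIn_eq_empty hcon] at h
    exact h
  have hne : ∀ x ∈ F, arcSign s s' x ≠ 0 := by
    intro x hx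
    induction x using Projectivization.ind with
    | h v hv =>
      rw [arcSign_mk]
      have key : ∀ (r : Fin 2 → ℝ) (hr : r ≠ 0), Projectivization.mk ℝ r hr ∉ F →
          cross v r ≠ 0 := by
        intro r hr hrF h0
        obtain ⟨c, hc⟩ := exists_smul_of_cross_eq_zero hr h0
        apply hrF
        rwa [← (Projectivization.mk_eq_mk_iff' ℝ v r hv hr).mpr ⟨c, hc.symm⟩]
      exact div_ne_zero (mul_ne_zero (key s hs hsF) (key s' hs' hsF')) (sq_add_sq_ne_zero hv)
  have hpre := (isPreconnected_connectedComponentIn (x := Projectivization.mk ℝ p hp) (F := F)).image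
    _ (continuous_arcSign s s').continuousOn
  have hord := hpre.ordConnected
  have hpm := Set.mem_image_of_mem (arcSign s s') (mem_connectedComponentIn hpF)
  have hqm := Set.mem_image_of_mem (arcSign s s') h
  have h0 : (0 : ℝ) ∉ arcSign s s' '' connectedComponentIn F (Projectivization.mk ℝ p hp) := by
    rintro ⟨x, hx, hx0⟩
    exact hne x (connectedComponentIn_subset _ _ hx) hx0
  rw [arcSign_mk] at hpm hqm
  have pos : ∀ {v : Fin 2 → ℝ}, v ≠ 0 → 0 < v 0 ^ 2 + v 1 ^ 2 := fun {v} hv =>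
    lt_of_le_of_ne (by positivity) (sq_add_sq_ne_zero hv).symm
  -- Intermediate value argument: with values of opposite sign at `p` and `q`, the order-connected
  -- image of the component would contain zero.
  by_contra hcon
  rw [not_lt, mul_nonpos_iff] at hcon
  rcases hcon with ⟨h1, h2⟩ | ⟨h1, h2⟩
  · exact h0 (hord.out hqm hpm ⟨div_nonpos_of_nonpos_of_nonneg h2 (pos hq).le,
      div_nonneg h1 (pos hp).le⟩)
  · exact h0 (hord.out hpm hqm ⟨div_nonpos_of_nonpos_of_nonneg h1 (pos hp).le,
      div_nonneg h2 (pos hq).le⟩)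

/-- Take `M` slightly above the largest `m d`: the finitely many strict inequalities hold at that
maximum and persist nearby. No sign of `n` matters. -/
theorem exists_gt_and_mul_lt_one {ι κ : Type*} [Finite ι] [Nonempty ι] [Finite κ] {m : ι → ℝ}
    {n : κ → ℝ} (h : ∀ d c, m d * n c < 1) :
    ∃ M : ℝ, (∀ d, m d < M) ∧ ∀ c, M * n c < 1 := by
  obtain ⟨d, hd⟩ := Finite.exists_max m
  have h1 : ∀ᶠ M in nhdsWithin (m d) (Set.Ioi (m d)), ∀ c, M * n c < 1 := by
    refine Filter.Eventually.filter_mono nhdsWithin_le_nhds ?_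
    rw [Filter.eventually_all]
    intro c
    exact (continuous_id.mul continuous_const).continuousAt.eventually_lt_const (h d c)
  obtain ⟨M, hM, hdM⟩ := (h1.and self_mem_nhdsWithin).exists
  exact ⟨M, fun d' => (hd d').trans_lt hdM, hM⟩

/-- The linear form `v ↦ cross v w`. -/
def crossLeft (w : Fin 2 → ℝ) : (Fin 2 → ℝ) →ₗ[ℝ] ℝ where
  toFun v := cross v w
  map_add' x y := by simp only [cross, Pi.add_apply]; ring
  map_smul' c x := by simp only [cross, Pi.smul_apply, smul_eq_mul, RingHom.id_apply]; ring

/-- Vectors `q d` and `s c` with `cross (q d) (s c) > 0` are separated by a quadratic form. -/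
theorem exists_quadraticForm_of_cross_pos {ι : Type*} [Finite ι] [Nonempty ι]
    {q s : ι → Fin 2 → ℝ} (h : ∀ d c, 0 < cross (q d) (s c)) :
    ∃ Q : QuadraticForm ℝ (Fin 2 → ℝ), (∀ d, 0 < Q (q d)) ∧ ∀ c, Q (s c) < 0 := by
  obtain ⟨e⟩ := ‹Nonempty ι›
  set α : (Fin 2 → ℝ) →ₗ[ℝ] ℝ := crossLeft (s e) with hα
  set β : (Fin 2 → ℝ) →ₗ[ℝ] ℝ := -crossLeft (q e) with hβ
  have hαq : ∀ d, 0 < α (q d) := fun d => h d e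
  have hβs : ∀ c, 0 < β (s c) := fun c => by
    have := h e c
    simp only [hβ, crossLeft, cross, LinearMap.neg_apply, LinearMap.coe_mk, AddHom.coe_mk] at this ⊢
    linarith
  -- By the Plücker relation the difference of the two sides is `cross (q d) (s c) * cross (q e) (s
  -- e)`.
  have key : ∀ d c, α (s c) * β (q d) < α (q d) * β (s c) := fun d c => by
    have h1 := mul_pos (h d c) (h e e)
    simp only [hα, hβ, crossLeft, cross, LinearMap.neg_apply, LinearMap.coe_mk,
      AddHom.coe_mk] at h1 ⊢
    linarith
  have hmn : ∀ d c, β (q d) / α (q d) * (α (s c) / β (s c)) < 1 := fun d c => by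
    rw [div_mul_div_comm, div_lt_one (mul_pos (hαq d) (hβs c)), mul_comm]
    exact key d c
  have : Nonempty ι := ⟨e⟩
  obtain ⟨M, hM, hM'⟩ := exists_gt_and_mul_lt_one hmn
  obtain ⟨N, hN, hN'⟩ := exists_gt_and_mul_lt_one
    (m := fun d => -(β (q d) / α (q d))) (n := fun c => -(α (s c) / β (s c)))
    (fun d c => by rw [neg_mul_neg]; exact hmn d c)
  -- In the coordinates `(α, β)` the two factors vanish on lines just above and just below the
  -- slopes `β / α` of all the `q d`. Both factors are positive on the `q d` and they have opposite
  -- signs on the `s c`.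
  refine ⟨QuadraticMap.linMulLin (M • α - β) (N • α + β), fun d => ?_, fun c => ?_⟩
  · rw [QuadraticMap.linMulLin_apply]
    have h1 := (div_lt_iff₀ (hαq d)).mp (hM d)
    have h2 := hN d
    rw [← neg_div] at h2
    have h2 := (div_lt_iff₀ (hαq d)).mp h2
    refine mul_pos ?_ ?_ <;>
      simp only [LinearMap.sub_apply, LinearMap.add_apply, LinearMap.smul_apply, smul_eq_mul] <;>
      linarith
  · rw [QuadraticMap.linMulLin_apply]
    have h1 := hM' c
    have h2 := hN' c
    rw [← mul_div_assoc, div_lt_one (hβs c)] at h1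
    rw [← neg_div, ← mul_div_assoc, div_lt_one (hβs c)] at h2
    refine mul_neg_of_neg_of_pos ?_ ?_ <;>
      simp only [LinearMap.sub_apply, LinearMap.add_apply, LinearMap.smul_apply, smul_eq_mul] <;>
      linarith

/-- A quadratic form that is positive on the expanding and negative on the contracting eigenvector
of a hyperbolic matrix increases under the matrix. -/
theorem quadraticForm_lt_of_eigenvectors {A : Matrix (Fin 2) (Fin 2) ℝ} {ξ : ℝ} (hξ : 1 < |ξ|)
    {q s : Fin 2 → ℝ} (hq : A *ᵥ q = ξ • q) (hs : A *ᵥ s = ξ⁻¹ • s) (hqs : cross q s ≠ 0)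
    {Q : QuadraticForm ℝ (Fin 2 → ℝ)} (hQq : 0 < Q q) (hQs : Q s < 0) {v : Fin 2 → ℝ}
    (hv : v ≠ 0) : Q v < Q (A *ᵥ v) := by
  obtain ⟨x, y, rfl⟩ : ∃ x y : ℝ, v = x • q + y • s := by
    refine ⟨(cross q s)⁻¹ * cross v s, (cross q s)⁻¹ * cross q v, ?_⟩
    rw [mul_smul, mul_smul, ← smul_add, ← cross_smul_eq, inv_smul_smul₀ hqs]
  have hξ0 : ξ ≠ 0 := by
    rintro rfl
    norm_num at hξ
  have hxy : x ≠ 0 ∨ y ≠ 0 := by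
    by_contra hcon
    push Not at hcon
    exact hv (by simp [hcon.1, hcon.2])
  have expand : ∀ a b : ℝ, Q (a • q + b • s)
      = a ^ 2 * Q q + b ^ 2 * Q s + a * b * QuadraticMap.polar Q q s := fun a b => by
    rw [QuadraticMap.map_add Q, QuadraticMap.map_smul, QuadraticMap.map_smul,
      QuadraticMap.polar_smul_left, QuadraticMap.polar_smul_right]
    simp only [smul_eq_mul]
    ring
  have hA : A *ᵥ (x • q + y • s) = (x * ξ) • q + (y * ξ⁻¹) • s := by
    rw [Matrix.mulVec_add, Matrix.mulVec_smul, Matrix.mulVec_smul, hq, hs, smul_smul, smul_smul]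
  rw [hA, expand, expand]
  -- The mixed term is invariant because the eigenvalues are reciprocal. Only the diagonal terms
  -- change, and both changes favour growth.
  have hcr : x * ξ * (y * ξ⁻¹) = x * y := by field_simp
  rw [hcr]
  have h1 : 1 < ξ ^ 2 := by rw [← sq_abs]; nlinarith
  have h2 : (ξ⁻¹) ^ 2 < 1 := by
    rw [inv_pow]
    exact inv_lt_one_of_one_lt₀ h1
  rw [mul_pow, mul_pow]
  have e1 : 0 ≤ x ^ 2 * (ξ ^ 2 - 1) * Q q := by
    have := sub_pos.mpr h1
    positivity
  have e2 : 0 ≤ y ^ 2 * (1 - ξ⁻¹ ^ 2) * (-Q s) := by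
    have := sub_pos.mpr h2
    have := neg_pos.mpr hQs
    positivity
  rcases hxy with h | h
  · have : 0 < x ^ 2 * (ξ ^ 2 - 1) * Q q := by
      have := sub_pos.mpr h1
      positivity
    linarith
  · have : 0 < y ^ 2 * (1 - ξ⁻¹ ^ 2) * (-Q s) := by
      have := sub_pos.mpr h2
      have := neg_pos.mpr hQs
      positivity
    linarith

/-- A finite family of hyperbolic matrices with the source-sink condition has a common quadratic
form that increases strictly under all of them. -/
theorem SourceSinkCondition.exists_quadraticForm {ι : Type*} [Finite ι] [Nonempty ι]
    {A : ι → Matrix (Fin 2) (Fin 2) ℝ} (hdet : ∀ d, (A d).det = 1)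
    (hhyp : ∀ d, IsHyperbolic (A d)) (hA : SourceSinkCondition A) :
    ∃ Q : QuadraticForm ℝ (Fin 2 → ℝ), ∀ d, ∀ v ≠ 0, Q v < Q (A d *ᵥ v) := by
  choose ξ hξ hroot using fun d => exists_root_of_two_lt_abs (hhyp d)
  have hξ0 : ∀ d, ξ d ≠ 0 := fun d h0 => by
    have := hξ d
    rw [h0] at this
    norm_num at this
  choose q hq0 hq using fun d => exists_eigenvector_of_root (hdet d) (hroot d)
  have hroot' : ∀ d, (ξ d)⁻¹ ^ 2 - (A d).trace * (ξ d)⁻¹ + 1 = 0 := fun d => by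
    have h0 := hξ0 d
    field_simp
    linear_combination hroot d
  choose s hs0 hs using fun d => exists_eigenvector_of_root (hdet d) (hroot' d)
  have hinv : ∀ d, |(ξ d)⁻¹| < 1 := fun d => by
    rw [abs_inv]
    exact inv_lt_one_of_one_lt₀ (hξ d)
  have hne : ∀ d, ξ d ≠ (ξ d)⁻¹ := fun d h => by
    have h1 := hξ d
    have h2 := hinv d
    rw [← h] at h2
    linarith
  have hsink : ∀ d, IsSink (A d) (Projectivization.mk ℝ (q d) (hq0 d)) := fun d =>
    ⟨ξ d, hξ d, by
      rw [Projectivization.submodule_mk]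
      exact eigenspace_eq_span (hne d) (hq0 d) (hs0 d) (hq d) (hs d)⟩
  have hsource : ∀ d, IsSource (A d) (Projectivization.mk ℝ (s d) (hs0 d)) := fun d =>
    ⟨(ξ d)⁻¹, hinv d, by
      rw [Projectivization.submodule_mk]
      exact eigenspace_eq_span (hne d).symm (hs0 d) (hq0 d) (hs d) (hq d)⟩
  have hcross : ∀ d e c c', 0 < (cross (q d) (s c) * cross (q d) (s c'))
      * (cross (q e) (s c) * cross (q e) (s c')) := fun d e c c' =>
    cross_pos_of_mem_connectedComponentIn (F := {x : RPOne | ∃ c, IsSource (A c) x}ᶜ)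
      (hs0 c) (hs0 c') (hq0 d) (hq0 e) (fun h => h ⟨c, hsource c⟩) (fun h => h ⟨c', hsource c'⟩)
      (hA d e _ _ (hsink d) (hsink e))
  obtain ⟨e⟩ := ‹Nonempty ι›
  -- Eigenvectors are determined only up to sign. Rescaling them against the reference index `e`
  -- makes all the cross products positive at once; the signs of `Q` on them are unaffected, as `Q`
  -- scales by squares.
  have hpos : ∀ d c, 0 < cross (cross (q d) (cross (q e) (s e) • s e) • q d)
      (cross (q e) (s c) • s c) := fun d c => by
    have h1 := hcross e d e c
    have e1 : cross (cross (q d) (cross (q e) (s e) • s e) • q d) (cross (q e) (s c) • s c)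
        = (cross (q e) (s e) * cross (q e) (s c)) * (cross (q d) (s e) * cross (q d) (s c)) := by
      simp only [cross, Pi.smul_apply, smul_eq_mul]
      ring
    rw [e1]
    exact h1
  have : Nonempty ι := ⟨e⟩
  obtain ⟨Q, hQq, hQs⟩ := exists_quadraticForm_of_cross_pos hpos
  refine ⟨Q, fun d v hv => ?_⟩
  have h1 := hQq d
  have h2 := hQs d
  rw [QuadraticMap.map_smul, smul_eq_mul] at h1 h2
  exact quadraticForm_lt_of_eigenvectors (hξ d) (hq d) (hs d)
    (cross_ne_zero_of_eigenvectors (hne d) (hq0 d) (hs0 d) (hq d) (hs d))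
    (pos_of_mul_pos_right h1 (mul_self_nonneg _))
    (neg_of_mul_neg_right h2 (mul_self_nonneg _)) hv

/-! ## Jacobi operators: self-adjointness and invertibility -/

theorem EllTwo.summable_sq (x : EllTwo) : Summable fun i => ‖x i‖ ^ 2 := by
  have := (lp.memℓp x).summable (by norm_num)
  simpa using this

theorem EllTwo.norm_sq_eq_tsum (x : EllTwo) : ‖x‖ ^ 2 = ∑' i, ‖x i‖ ^ 2 := by
  have := lp.norm_rpow_eq_tsum (p := 2) (by norm_num) x
  simpa using this

/-- Reindexing by `k` moves the shift to the other factor, and real weights survive conjugation. The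
two off-diagonal shifts of a Jacobi operator are therefore adjoint to each other. -/
theorem inner_weightedShift (c : ℤ → ℝ) (hc : ∃ C, ∀ i, |c i| ≤ C) (k : ℤ) (c' : ℤ → ℝ)
    (hc' : ∃ C, ∀ i, |c' i| ≤ C) (k' : ℤ) (hk : k' = -k) (h : ∀ i, c' i = c (i - k))
    (x y : EllTwo) :
    inner ℂ (weightedShift c hc k x) y = inner ℂ x (weightedShift c' hc' k' y) := by
  subst hk
  rw [lp.inner_eq_tsum, lp.inner_eq_tsum, ← (Equiv.addRight k).tsum_eq fun i => inner ℂ (x i) _]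
  refine tsum_congr fun i => ?_
  simp only [weightedShift_apply, Equiv.coe_addRight, h, add_sub_cancel_right,
    add_neg_cancel_right, RCLike.inner_apply, map_mul, Complex.conj_ofReal]
  ring

theorem isSelfAdjoint_jacobiOperator (a b : ℤ → ℝ) (ha : ∃ C, ∀ i, |a i| ≤ C)
    (hb : ∃ C, ∀ i, |b i| ≤ C) : IsSelfAdjoint (jacobiOperator a b ha hb) := by
  rw [ContinuousLinearMap.isSelfAdjoint_iff_isSymmetric]
  intro x y
  have ha' : ∃ C, ∀ i, |a (i - 1)| ≤ C := ha.imp fun _ h i => h (i - 1)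
  change inner ℂ (jacobiOperator a b ha hb x) y = inner ℂ x (jacobiOperator a b ha hb y)
  simp only [jacobiOperator, add_apply, inner_add_left, inner_add_right]
  rw [inner_weightedShift _ ha' (-1) a ha 1 (by norm_num) (fun i => by norm_num),
    inner_weightedShift a ha 1 _ ha' (-1) (by norm_num) (fun i => rfl),
    inner_weightedShift b hb 0 b hb 0 (by norm_num) (fun i => by norm_num)]
  ring

/-- A self-adjoint operator that is bounded below is invertible. -/
theorem isUnit_of_isSelfAdjoint_of_bound {E : Type*} [NormedAddCommGroup E]
    [InnerProductSpace ℂ E] [CompleteSpace E] {T : E →L[ℂ] E} (hT : IsSelfAdjoint T) (K : ℝ)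
    (h : ∀ x, ‖x‖ ≤ K * ‖T x‖) : IsUnit T := by
  have hK : ∀ x, ‖x‖ ≤ (K.toNNReal : ℝ) * ‖T x‖ := fun x =>
    (h x).trans (mul_le_mul_of_nonneg_right (Real.le_coe_toNNReal K) (norm_nonneg _))
  have hanti : AntilipschitzWith K.toNNReal T := T.antilipschitz_of_bound hK
  rw [ContinuousLinearMap.isUnit_iff_bijective,
    ContinuousLinearMap.bijective_iff_dense_range_and_antilipschitz]
  refine ⟨?_, _, hanti⟩
  -- The orthogonal complement of the range is the kernel of the adjoint, here `T` itself, which is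
  -- injective.
  rw [Submodule.topologicalClosure_eq_top_iff, ContinuousLinearMap.orthogonal_range,
    ContinuousLinearMap.isSelfAdjoint_iff'.mp hT]
  exact LinearMap.ker_eq_bot.mpr hanti.injective

/-! ## Summation of a Lyapunov inequality -/

/-- `ε` is the minimum over the compact unit sphere, extended by homogeneity; an empty sphere means
that `V` is trivial. -/
theorem exists_pos_mul_norm_sq_le {V : Type*} [NormedAddCommGroup V] [NormedSpace ℝ V]
    [FiniteDimensional ℝ V] (Q : QuadraticForm ℝ V) (hQ : ∀ v ≠ 0, 0 < Q v) :
    ∃ ε > 0, ∀ v, ε * ‖v‖ ^ 2 ≤ Q v := by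
  have hcont : Continuous Q := by
    have : (Q : V → ℝ) = fun v => (2 : ℝ)⁻¹ * Q.polarBilin.toContinuousBilinearMap v v := by
      funext v
      rw [LinearMap.toContinuousBilinearMap_apply, QuadraticMap.polarBilin_apply_apply,
        QuadraticMap.polar_self]
      simp
    rw [this]
    fun_prop
  by_cases hne : (Metric.sphere (0 : V) 1).Nonempty
  · obtain ⟨v₀, hv₀, hmin⟩ := (isCompact_sphere (0 : V) 1).exists_isMinOn hne hcont.continuousOn
    have hv₀' : v₀ ≠ 0 := by
      rintro rfl
      simp at hv₀
    refine ⟨Q v₀, hQ v₀ hv₀', fun v => ?_⟩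
    by_cases hv : v = 0
    · simp [hv]
    have hn : ‖v‖ ≠ 0 := norm_ne_zero_iff.mpr hv
    have h1 : Q v₀ ≤ Q (‖v‖⁻¹ • v) := hmin (by simp [norm_smul, hn])
    have h2 := QuadraticMap.map_smul Q ‖v‖ (‖v‖⁻¹ • v)
    rw [smul_inv_smul₀ hn, smul_eq_mul] at h2
    rw [h2, mul_comm, ← sq]
    exact mul_le_mul_of_nonneg_left h1 (sq_nonneg _)
  · refine ⟨1, one_pos, fun v => ?_⟩
    by_cases hv : v = 0
    · simp [hv]
    · exact absurd ⟨‖v‖⁻¹ • v, by simp [norm_smul, norm_ne_zero_iff.mpr hv]⟩ hne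

theorem exists_abs_polar_le {V : Type*} [NormedAddCommGroup V] [NormedSpace ℝ V]
    [FiniteDimensional ℝ V] (Q : QuadraticForm ℝ V) :
    ∃ C, 0 ≤ C ∧ ∀ v w, |QuadraticMap.polar Q v w| ≤ C * ‖v‖ * ‖w‖ :=
  ⟨‖Q.polarBilin.toContinuousBilinearMap‖, ContinuousLinearMap.opNorm_nonneg _, fun v w =>
    Q.polarBilin.toContinuousBilinearMap.le_opNorm₂ v w⟩

theorem exists_abs_quadraticForm_le {V : Type*} [NormedAddCommGroup V] [NormedSpace ℝ V]
    [FiniteDimensional ℝ V] (Q : QuadraticForm ℝ V) : ∃ C, 0 ≤ C ∧ ∀ v, |Q v| ≤ C * ‖v‖ ^ 2 := by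
  obtain ⟨C, hC, h⟩ := exists_abs_polar_le Q
  refine ⟨C, hC, fun v => ?_⟩
  have := h v v
  rw [QuadraticMap.polar_self, nsmul_eq_mul, abs_mul] at this
  norm_num at this
  nlinarith [abs_nonneg (Q v)]

/-- If `R ∘ P - S` is positive definite, then `R` increases along `w ↦ P w + g` up to an error that
is quadratic in `g`. -/
theorem exists_lyapunov_bound {V : Type*} [NormedAddCommGroup V] [NormedSpace ℝ V]
    [FiniteDimensional ℝ V] (S R : QuadraticForm ℝ V) (P : V →ₗ[ℝ] V)
    (h : ∀ w ≠ 0, S w < R (P w)) :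
    ∃ ε > 0, ∃ K, 0 ≤ K ∧ ∀ w g, S w + ε * ‖w‖ ^ 2 - K * ‖g‖ ^ 2 ≤ R (P w + g) := by
  obtain ⟨ε, hε, hlow⟩ := exists_pos_mul_norm_sq_le (R.comp P - S) fun v hv => by
    rw [sub_apply, QuadraticMap.comp_apply]
    exact sub_pos.mpr (h v hv)
  obtain ⟨C, hC, hpol⟩ := exists_abs_polar_le R
  obtain ⟨C', hC', hR⟩ := exists_abs_quadraticForm_le R
  set p := ‖P.toContinuousLinearMap‖ with hp
  have hPw : ∀ w, ‖P w‖ ≤ p * ‖w‖ := fun w => P.toContinuousLinearMap.le_opNorm w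
  refine ⟨ε / 2, half_pos hε, C' + (C * p) ^ 2 / (2 * ε), by positivity, fun w g => ?_⟩
  have h1 := hlow w
  rw [sub_apply, QuadraticMap.comp_apply] at h1
  rw [QuadraticMap.map_add R]
  have h2 := neg_le_of_abs_le (hR g)
  have h3 := neg_le_of_abs_le (hpol (P w) g)
  have h4 : C * ‖P w‖ * ‖g‖ ≤ C * (p * ‖w‖) * ‖g‖ := by
    have := hPw w
    gcongr
  -- Young's inequality: the mixed term costs half of the gain `ε`, and the rest is charged to `g`.
  have h5 : C * (p * ‖w‖) * ‖g‖ ≤ ε / 2 * ‖w‖ ^ 2 + (C * p) ^ 2 / (2 * ε) * ‖g‖ ^ 2 := by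
    have h6 : 0 ≤ (ε * ‖w‖ - C * p * ‖g‖) ^ 2 / (2 * ε) := by positivity
    have h7 : (ε * ‖w‖ - C * p * ‖g‖) ^ 2 / (2 * ε)
        = ε / 2 * ‖w‖ ^ 2 + (C * p) ^ 2 / (2 * ε) * ‖g‖ ^ 2 - C * (p * ‖w‖) * ‖g‖ := by
      field_simp
      ring
    linarith
  linarith

/-- Telescoping a Lyapunov inequality over the integers. -/
theorem tsum_norm_sq_le_of_lyapunov {V : Type*} [NormedAddCommGroup V] {w g : ℤ → V}
    (hw : Summable fun i => ‖w i‖ ^ 2) (hg : Summable fun i => ‖g i‖ ^ 2) {F : ℤ → V → ℝ}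
    {C ε K : ℝ} (hF : ∀ i v, |F i v| ≤ C * ‖v‖ ^ 2)
    (h : ∀ i, F i (w i) + ε * ‖w i‖ ^ 2 - K * ‖g i‖ ^ 2 ≤ F (i + 1) (w (i + 1))) :
    ε * ∑' i, ‖w i‖ ^ 2 ≤ K * ∑' i, ‖g i‖ ^ 2 := by
  have hs : Summable fun i => F i (w i) :=
    Summable.of_norm_bounded (hw.mul_left C) fun i => hF i (w i)
  have hs' : Summable fun i => F (i + 1) (w (i + 1)) :=
    hs.comp_injective (add_left_injective (1 : ℤ))
  have heq : ∑' i, F (i + 1) (w (i + 1)) = ∑' i, F i (w i) :=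
    (Equiv.addRight (1 : ℤ)).tsum_eq fun i => F i (w i)
  have hle := ((hs.add (hw.mul_left ε)).sub (hg.mul_left K)).tsum_le_tsum h hs'
  rw [(hs.add (hw.mul_left ε)).tsum_sub (hg.mul_left K), hs.tsum_add (hw.mul_left ε), heq,
    tsum_mul_left, tsum_mul_left] at hle
  linarith

/-! ## Propagation through a block -/

theorem Resonator.det_propagation (R : Resonator) (lam : ℝ) : (R.propagation lam).det = 1 := by
  simp only [Resonator.propagation, Matrix.det_fin_two_of]
  ring

/-- The scaling factor that turns the generalized capacitance problem into a symmetric one. -/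
noncomputable def Resonator.weight (R : Resonator) : ℝ := R.speed / √R.length

theorem Resonator.weight_pos (R : Resonator) : 0 < R.weight :=
  div_pos R.speed_pos (Real.sqrt_pos.mpr R.length_pos)

theorem Resonator.weight_sq (R : Resonator) : R.weight ^ 2 = R.speed ^ 2 / R.length := by
  rw [Resonator.weight, div_pow, Real.sq_sqrt R.length_pos.le]

theorem Resonator.length_div_speed_sq (R : Resonator) :
    R.length / R.speed ^ 2 = (R.weight ^ 2)⁻¹ := by
  rw [R.weight_sq, inv_div]

namespace BlockLibrary

variable {D : ℕ} (B : BlockLibrary D)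

/-- The propagation matrix of the first `r` resonators of the block `d`. -/
noncomputable def partialPropagation (lam : ℝ) (d : Fin D) (r : ℕ) : Matrix (Fin 2) (Fin 2) ℝ :=
  ((List.ofFn fun k : Fin (B.len d) => (B.resonator d k).propagation lam).take r).reverse.prod

theorem partialPropagation_zero (lam : ℝ) (d : Fin D) : B.partialPropagation lam d 0 = 1 := by
  simp [partialPropagation]

theorem partialPropagation_len (lam : ℝ) (d : Fin D) :
    B.partialPropagation lam d (B.len d) = B.blockPropagation lam d := by
  rw [partialPropagation, List.take_of_length_le (by simp)]
  rfl

theorem partialPropagation_succ (lam : ℝ) (d : Fin D) (r : Fin (B.len d)) :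
    B.partialPropagation lam d (r + 1)
      = (B.resonator d r).propagation lam * B.partialPropagation lam d r := by
  rw [partialPropagation, List.take_succ_eq_append_getElem (by simp)]
  simp [partialPropagation]

theorem det_partialPropagation (lam : ℝ) (d : Fin D) (r : ℕ) (hr : r ≤ B.len d) :
    (B.partialPropagation lam d r).det = 1 := by
  induction r with
  | zero => simp [partialPropagation_zero]
  | succ r ih =>
    rw [B.partialPropagation_succ lam d ⟨r, hr⟩, Matrix.det_mul, Resonator.det_propagation,
      ih (by omega), one_mul]

theorem det_blockPropagation (lam : ℝ) (d : Fin D) : (B.blockPropagation lam d).det = 1 := by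
  rw [← partialPropagation_len]
  exact B.det_partialPropagation lam d _ le_rfl

/-! ## The array in terms of slots -/

theorem slotAt_add_one (χ : ℤ → Fin D) (i : ℤ) :
    B.slotAt χ (i + 1) = B.nextSlot χ (B.slotAt χ i) := by
  rw [slotAt, add_comm, zpow_one_add]
  rfl

/-! ## The interpolated Lyapunov forms -/

/-- Interpolation inside the block `d` between a form `Q` on its left end and the form `Q` on its
right end. -/
noncomputable def interpolatedForm (lam : ℝ) (Q : QuadraticForm ℝ (Fin 2 → ℝ)) (d : Fin D)
    (r : ℕ) : QuadraticForm ℝ (Fin 2 → ℝ) :=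
  (Q + ((r : ℝ) / B.len d) • (Q.comp (Matrix.toLin' (B.blockPropagation lam d)) - Q)).comp
    (Matrix.toLin' (B.partialPropagation lam d r)⁻¹)

/-- Along the orbit of `v` through the block the value is affine in `r`, so each resonator receives
an equal share of the gain of `Q` over the whole block. -/
theorem interpolatedForm_apply (lam : ℝ) (Q : QuadraticForm ℝ (Fin 2 → ℝ)) (d : Fin D) (r : ℕ)
    (hr : r ≤ B.len d) (v : Fin 2 → ℝ) :
    B.interpolatedForm lam Q d r (B.partialPropagation lam d r *ᵥ v)
      = Q v + (r : ℝ) / B.len d * (Q (B.blockPropagation lam d *ᵥ v) - Q v) := by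
  have hu : IsUnit (B.partialPropagation lam d r).det := by
    rw [B.det_partialPropagation lam d r hr]
    exact isUnit_one
  simp only [interpolatedForm, QuadraticMap.comp_apply, Matrix.toLin'_apply, Matrix.mulVec_mulVec,
    Matrix.nonsing_inv_mul _ hu, Matrix.one_mulVec, add_apply, sub_apply,
    smul_apply, smul_eq_mul]

theorem interpolatedForm_zero (lam : ℝ) (Q : QuadraticForm ℝ (Fin 2 → ℝ)) (d : Fin D) :
    B.interpolatedForm lam Q d 0 = Q := by
  ext v
  have := B.interpolatedForm_apply lam Q d 0 (Nat.zero_le _) v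
  rw [partialPropagation_zero, Matrix.one_mulVec] at this
  simpa using this

theorem exists_mulVec_eq_of_det_eq_one {A : Matrix (Fin 2) (Fin 2) ℝ} (hA : A.det = 1)
    (w : Fin 2 → ℝ) : ∃ v, w = A *ᵥ v :=
  ⟨A⁻¹ *ᵥ w, by
    rw [Matrix.mulVec_mulVec, Matrix.mul_nonsing_inv _ (by rw [hA]; exact isUnit_one),
      Matrix.one_mulVec]⟩

theorem interpolatedForm_len (lam : ℝ) (Q : QuadraticForm ℝ (Fin 2 → ℝ)) (d : Fin D) :
    B.interpolatedForm lam Q d (B.len d) = Q := by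
  ext w
  obtain ⟨v, rfl⟩ := exists_mulVec_eq_of_det_eq_one
    (B.det_partialPropagation lam d _ le_rfl) w
  have hlen : (B.len d : ℝ) ≠ 0 := Nat.cast_ne_zero.mpr (B.len_pos d).ne'
  rw [B.interpolatedForm_apply lam Q d _ le_rfl, div_self hlen, partialPropagation_len]
  ring

theorem interpolatedForm_lt (lam : ℝ) {Q : QuadraticForm ℝ (Fin 2 → ℝ)} {d : Fin D}
    (hQ : ∀ v ≠ 0, Q v < Q (B.blockPropagation lam d *ᵥ v)) (r : Fin (B.len d))
    {w : Fin 2 → ℝ} (hw : w ≠ 0) :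
    B.interpolatedForm lam Q d r w
      < B.interpolatedForm lam Q d (r + 1) ((B.resonator d r).propagation lam *ᵥ w) := by
  obtain ⟨v, rfl⟩ := exists_mulVec_eq_of_det_eq_one
    (B.det_partialPropagation lam d r r.2.le) w
  have hv : v ≠ 0 := by
    rintro rfl
    simp at hw
  rw [B.interpolatedForm_apply lam Q d _ r.2.le, Matrix.mulVec_mulVec,
    ← partialPropagation_succ, B.interpolatedForm_apply lam Q d _ r.2]
  have hlen : (0 : ℝ) < B.len d := Nat.cast_pos.mpr (B.len_pos d)
  have h1 := sub_pos.mpr (hQ v hv)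
  gcongr
  exact lt_add_one _

/-- At a block boundary both sides equal `Q`, whichever block follows; this is where a form common
to all blocks is needed. -/
theorem interpolatedForm_nextSlot (lam : ℝ) (Q : QuadraticForm ℝ (Fin 2 → ℝ)) (χ : ℤ → Fin D)
    (p : B.Slot χ) :
    B.interpolatedForm lam Q (χ (B.nextSlot χ p).1) (B.nextSlot χ p).2
      = B.interpolatedForm lam Q (χ p.1) (p.2 + 1) := by
  by_cases h : (p.2 : ℕ) + 1 < B.len (χ p.1)
  · rw [show B.nextSlot χ p = ⟨p.1, ⟨(p.2 : ℕ) + 1, h⟩⟩ from dif_pos h]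
  · rw [show B.nextSlot χ p = ⟨p.1 + 1, ⟨0, B.len_pos _⟩⟩ from dif_neg h,
      show (p.2 : ℕ) + 1 = B.len (χ p.1) by have := p.2.2; omega, interpolatedForm_len,
      interpolatedForm_zero]

theorem interpolatedForm_labelAt_add_one (lam : ℝ) (Q : QuadraticForm ℝ (Fin 2 → ℝ))
    (χ : ℤ → Fin D) (i : ℤ) :
    B.interpolatedForm lam Q (B.labelAt χ (i + 1)).1 (B.labelAt χ (i + 1)).2
      = B.interpolatedForm lam Q (B.labelAt χ i).1 ((B.labelAt χ i).2 + 1) := by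
  simp only [labelAt]
  rw [slotAt_add_one, interpolatedForm_nextSlot]

/-! ## The Jacobi operator and the propagation of states -/

theorem offDiag_eq (χ : ℤ → Fin D) (i : ℤ) :
    B.offDiag χ i = -((B.resonatorAt χ i).weight * (B.resonatorAt χ (i + 1)).weight
      / (B.resonatorAt χ i).spacing) := by
  rw [offDiag, Real.sqrt_mul (B.resonatorAt χ i).length_pos.le, Resonator.weight,
    Resonator.weight, div_mul_div_comm, div_div, mul_comm (B.resonatorAt χ i).spacing]

theorem diag_eq (χ : ℤ → Fin D) (i : ℤ) :
    B.diag χ i = (B.resonatorAt χ i).weight ^ 2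
      * (1 / (B.resonatorAt χ (i - 1)).spacing + 1 / (B.resonatorAt χ i).spacing) := by
  rw [diag, Resonator.weight_sq]

/-- There are finitely many labels, so all constants attached to resonators are uniform along the
array. -/
theorem exists_bound_of_label (f : B.Label → ℝ) (χ : ℤ → Fin D) :
    ∃ C, 0 < C ∧ ∀ i, f (B.labelAt χ i) ≤ C := by
  obtain ⟨C, hC⟩ := (Set.finite_range f).bddAbove
  exact ⟨max C 1, lt_max_of_lt_right one_pos, fun i => (hC ⟨_, rfl⟩).trans (le_max_left _ _)⟩

theorem norm_vec_sq_le (v : Fin 2 → ℝ) : ‖v‖ ^ 2 ≤ v 0 ^ 2 + v 1 ^ 2 := by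
  have h : ‖v‖ ≤ √(v 0 ^ 2 + v 1 ^ 2) := by
    rw [pi_norm_le_iff_of_nonneg (Real.sqrt_nonneg _)]
    intro i
    rw [Real.norm_eq_abs]
    apply Real.abs_le_sqrt
    fin_cases i
    · exact le_add_of_nonneg_right (sq_nonneg _)
    · exact le_add_of_nonneg_left (sq_nonneg _)
  calc ‖v‖ ^ 2 ≤ √(v 0 ^ 2 + v 1 ^ 2) ^ 2 := by gcongr
    _ = _ := Real.sq_sqrt (by positivity)

theorem sq_apply_le_norm_vec_sq (v : Fin 2 → ℝ) (i : Fin 2) : v i ^ 2 ≤ ‖v‖ ^ 2 := by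
  rw [← sq_abs]
  exact pow_le_pow_left₀ (abs_nonneg _) (norm_le_pi_norm v i) 2

/-- With a common Lyapunov form for all blocks, the real Jacobi equation is bounded below. -/
theorem exists_tsum_sq_le (χ : ℤ → Fin D) (lam : ℝ) {Q : QuadraticForm ℝ (Fin 2 → ℝ)}
    (hQ : ∀ d, ∀ v ≠ 0, Q v < Q (B.blockPropagation lam d *ᵥ v)) :
    ∃ K, 0 ≤ K ∧ ∀ X Y : ℤ → ℝ, Summable (fun i => X i ^ 2) → Summable (fun i => Y i ^ 2) →
      (∀ i, Y i = B.offDiag χ (i - 1) * X (i - 1) + B.offDiag χ i * X (i + 1)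
        + B.diag χ i * X i - lam * X i) →
      ∑' i, X i ^ 2 ≤ K * ∑' i, Y i ^ 2 := by
  choose ε hε K hK0 hK using fun p : B.Label =>
    exists_lyapunov_bound (B.interpolatedForm lam Q p.1 p.2)
      (B.interpolatedForm lam Q p.1 (p.2 + 1))
      (Matrix.toLin' ((B.ofLabel p).propagation lam))
      (fun w hw => B.interpolatedForm_lt lam (hQ p.1) p.2 hw)
  choose C hC0 hC using fun p : B.Label =>
    exists_abs_quadraticForm_le (B.interpolatedForm lam Q p.1 p.2)
  obtain ⟨Ki, hKi0, hKi⟩ := B.exists_bound_of_label K χ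
  obtain ⟨Ci, hCi0, hCi⟩ := B.exists_bound_of_label C χ
  -- An upper bound for the inverses yields the uniform positive gain `Ei⁻¹`.
  obtain ⟨Ei, hEi0, hEi⟩ := B.exists_bound_of_label (fun p => (ε p)⁻¹) χ
  obtain ⟨S, hS0, hS⟩ := B.exists_bound_of_label (fun p => (B.ofLabel p).spacing) χ
  obtain ⟨S', hS'0, hS'⟩ := B.exists_bound_of_label (fun p => ((B.ofLabel p).spacing)⁻¹) χ
  obtain ⟨U, hU0, hU⟩ := B.exists_bound_of_label (fun p => (B.ofLabel p).weight) χ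
  obtain ⟨U', hU'0, hU'⟩ := B.exists_bound_of_label (fun p => ((B.ofLabel p).weight)⁻¹) χ
  have hsp := fun i => (B.resonatorAt χ i).spacing_pos
  have hwp := fun i => (B.resonatorAt χ i).weight_pos
  refine ⟨U' ^ 2 * (Ei * (Ki * ((S ^ 2 + 1) * U' ^ 2))), by positivity,
    fun X Y hX hY hXY => ?_⟩
  set ω := fun i => (B.resonatorAt χ i).weight with hω
  set s := fun i => (B.resonatorAt χ i).spacing with hs
  have hω0 : ∀ i, ω i ≠ 0 := fun i => (hwp i).ne'
  have hs0 : ∀ i, s i ≠ 0 := fun i => (hsp i).ne'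
  set u := fun i => ω i * X i with hu
  set p := fun i => (u i - u (i - 1)) / s (i - 1) with hp
  set w : ℤ → Fin 2 → ℝ := fun i => ![u i, p i] with hw
  set g : ℤ → Fin 2 → ℝ := fun i => ![-(s i * (Y i / ω i)), -(Y i / ω i)] with hg
  have hstep : ∀ i, w (i + 1) = (B.resonatorAt χ i).propagation lam *ᵥ w i + g i := fun i => by
    -- This is the Jacobi equation at `i` divided by `ω i`: its coupling terms are the difference of
    -- the two adjacent fluxes.
    have hflux : p (i + 1) = p i - lam * ((ω i ^ 2)⁻¹ * u i) - Y i / ω i := by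
      have h1 := hω0 i
      have h2 := hs0 i
      have h3 := hs0 (i - 1)
      simp only [hp, hu, hXY, offDiag_eq, diag_eq, add_sub_cancel_right, sub_add_cancel]
      change _ = _ - (-(ω (i - 1) * ω i / s (i - 1)) * X (i - 1) + -(ω i * ω (i + 1) / s i) *
        X (i + 1) + ω i ^ 2 * (1 / s (i - 1) + 1 / s i) * X i - lam * X i) / ω i
      field_simp
      ring
    have hdisp : u (i + 1) = u i + s i * p (i + 1) := by
      have h2 := hs0 i
      simp only [hp, add_sub_cancel_right]
      field_simp
      ring
    have hm : (B.resonatorAt χ i).length / (B.resonatorAt χ i).speed ^ 2 = (ω i ^ 2)⁻¹ :=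
      Resonator.length_div_speed_sq _
    simp only [hw, hg, Resonator.propagation, hm]
    rw [hdisp, hflux]
    funext j
    fin_cases j
    · simp only [Fin.zero_eta, Matrix.cons_val_zero, Matrix.mulVec_cons, Matrix.mulVec_empty,
        Pi.add_apply]
      simp
      rw [show (B.resonatorAt χ i).spacing = s i from rfl]
      ring
    · simp
      ring
  have hωU : ∀ i, ω i ≤ U := hU
  have hωU' : ∀ i, (ω i)⁻¹ ≤ U' := hU'
  have hsS : ∀ i, s i ≤ S := hS
  have hsS' : ∀ i, (s i)⁻¹ ≤ S' := hS'
  have hωp : ∀ i, 0 < ω i := hwp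
  have hspp : ∀ i, 0 < s i := hsp
  have husq : ∀ i, u i ^ 2 ≤ U ^ 2 * X i ^ 2 := fun i => by
    rw [hu, mul_pow]
    have := hωU i
    have := (hωp i).le
    gcongr
  have hXsq : ∀ i, X i ^ 2 ≤ U' ^ 2 * ‖w i‖ ^ 2 := fun i => by
    have h1 : X i = (ω i)⁻¹ * u i := by rw [hu, inv_mul_cancel_left₀ (hω0 i)]
    rw [h1, mul_pow]
    have := hωU' i
    have h2 := (inv_pos.mpr (hωp i)).le
    have h3 : u i ^ 2 ≤ ‖w i‖ ^ 2 := sq_apply_le_norm_vec_sq (w i) 0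
    gcongr
  have husum : Summable fun i => u i ^ 2 :=
    Summable.of_nonneg_of_le (fun i => sq_nonneg _) husq (hX.mul_left _)
  have husum' : Summable fun i => u (i - 1) ^ 2 := 
    husum.comp_injective (sub_left_injective (b := (1 : ℤ)))
  have hpsq : ∀ i, p i ^ 2 ≤ S' ^ 2 * (2 * u i ^ 2 + 2 * u (i - 1) ^ 2) := fun i => by
    simp only [hp]
    rw [div_eq_inv_mul, mul_pow]
    have := hsS' (i - 1)
    have h2 := (inv_pos.mpr (hspp (i - 1))).le
    have h3 : (u i - u (i - 1)) ^ 2 ≤ 2 * u i ^ 2 + 2 * u (i - 1) ^ 2 := by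
      nlinarith [sq_nonneg (u i + u (i - 1))]
    gcongr
  have hpsum : Summable fun i => p i ^ 2 :=
    Summable.of_nonneg_of_le (fun i => sq_nonneg _) hpsq
      (((husum.mul_left 2).add (husum'.mul_left 2)).mul_left _)
  have hwsum : Summable fun i => ‖w i‖ ^ 2 :=
    Summable.of_nonneg_of_le (fun i => sq_nonneg _) (fun i => norm_vec_sq_le (w i))
      (husum.add hpsum)
  have hgsq : ∀ i, ‖g i‖ ^ 2 ≤ (S ^ 2 + 1) * U' ^ 2 * Y i ^ 2 := fun i => by
    refine (norm_vec_sq_le (g i)).trans ?_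
    have e1 : g i 0 ^ 2 + g i 1 ^ 2 = (s i ^ 2 + 1) * ((ω i)⁻¹) ^ 2 * Y i ^ 2 := by
      simp [hg]
      ring
    rw [e1]
    have := hωU' i
    have h2 := (inv_pos.mpr (hωp i)).le
    have := hsS i
    have h3 := (hspp i).le
    gcongr
  have hgsum : Summable fun i => ‖g i‖ ^ 2 :=
    Summable.of_nonneg_of_le (fun i => sq_nonneg _) hgsq (hY.mul_left _)
  have hlyap := tsum_norm_sq_le_of_lyapunov (C := Ci) (ε := Ei⁻¹) (K := Ki) hwsum hgsum
    (F := fun i v => B.interpolatedForm lam Q (B.labelAt χ i).1 (B.labelAt χ i).2 v)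
    (fun i v => (hC _ v).trans (by have := hCi i; gcongr))
    (fun i => by
      rw [interpolatedForm_labelAt_add_one, hstep]
      refine le_trans ?_ (hK (B.labelAt χ i) (w i) (g i))
      have h1 := hKi i
      have h2 : Ei⁻¹ ≤ ε (B.labelAt χ i) := inv_le_of_inv_le₀ (hε _) (hEi i)
      gcongr)
  have hXw : ∑' i, X i ^ 2 ≤ U' ^ 2 * ∑' i, ‖w i‖ ^ 2 := by
    rw [← tsum_mul_left]
    exact hX.tsum_le_tsum hXsq (hwsum.mul_left _)
  have hgY : ∑' i, ‖g i‖ ^ 2 ≤ (S ^ 2 + 1) * U' ^ 2 * ∑' i, Y i ^ 2 := by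
    rw [← tsum_mul_left]
    exact hgsum.tsum_le_tsum hgsq (hY.mul_left _)
  have hwg : ∑' i, ‖w i‖ ^ 2 ≤ Ei * (Ki * ∑' i, ‖g i‖ ^ 2) := by
    rwa [inv_mul_le_iff₀ hEi0] at hlyap
  calc ∑' i, X i ^ 2 ≤ U' ^ 2 * ∑' i, ‖w i‖ ^ 2 := hXw
    _ ≤ U' ^ 2 * (Ei * (Ki * ∑' i, ‖g i‖ ^ 2)) := by gcongr
    _ ≤ U' ^ 2 * (Ei * (Ki * ((S ^ 2 + 1) * U' ^ 2 * ∑' i, Y i ^ 2))) := by gcongr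
    _ = _ := by ring

/-! ### From the lower bound to the resolvent set. -/

theorem jacobi_sub_apply (χ : ℤ → Fin D) (lam : ℝ) (x : EllTwo) (i : ℤ) :
    (B.jacobi χ - algebraMap ℂ (EllTwo →L[ℂ] EllTwo) lam) x i
      = (B.offDiag χ (i - 1) : ℂ) * x (i - 1) + (B.offDiag χ i : ℂ) * x (i + 1)
        + (B.diag χ i : ℂ) * x i - lam * x i := by
  rw [← jacobiOperator_apply _ _ (B.offDiag_bounded χ) (B.diag_bounded χ)]
  rfl

/-- The coefficients and `lam` are real, so the real and imaginary parts of `x` each satisfy the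
real equation, and their two bounds add up. -/
theorem notMem_spectrum_of_lyapunov (χ : ℤ → Fin D) (lam : ℝ)
    {Q : QuadraticForm ℝ (Fin 2 → ℝ)}
    (hQ : ∀ d, ∀ v ≠ 0, Q v < Q (B.blockPropagation lam d *ᵥ v)) :
    (lam : ℂ) ∉ spectrum ℂ (B.jacobi χ) := by
  rw [spectrum.notMem_iff, IsUnit.sub_iff]
  obtain ⟨K, hK0, hK⟩ := B.exists_tsum_sq_le χ lam hQ
  have hsa : IsSelfAdjoint (B.jacobi χ - algebraMap ℂ (EllTwo →L[ℂ] EllTwo) lam) := by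
    refine (isSelfAdjoint_jacobiOperator _ _ _ _).sub ?_
    exact IsSelfAdjoint.algebraMap _ (Complex.conj_ofReal lam)
  refine isUnit_of_isSelfAdjoint_of_bound hsa √K fun x => ?_
  set y := (B.jacobi χ - algebraMap ℂ (EllTwo →L[ℂ] EllTwo) lam) x with hy
  have hsplit : ∀ z : EllTwo, Summable (fun i => (z i).re ^ 2) ∧ Summable (fun i => (z i).im ^ 2) ∧
      ‖z‖ ^ 2 = ∑' i, (z i).re ^ 2 + ∑' i, (z i).im ^ 2 := fun z => by
    have h := EllTwo.summable_sq z
    have e : ∀ i, ‖z i‖ ^ 2 = (z i).re ^ 2 + (z i).im ^ 2 := fun i => by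
      rw [← Complex.normSq_eq_norm_sq, Complex.normSq_apply]
      ring
    have h1 : Summable (fun i => (z i).re ^ 2) :=
      Summable.of_nonneg_of_le (fun i => sq_nonneg _)
        (fun i => by rw [e]; exact le_add_of_nonneg_right (sq_nonneg _)) h
    have h2 : Summable (fun i => (z i).im ^ 2) :=
      Summable.of_nonneg_of_le (fun i => sq_nonneg _)
        (fun i => by rw [e]; exact le_add_of_nonneg_left (sq_nonneg _)) h
    refine ⟨h1, h2, ?_⟩
    rw [EllTwo.norm_sq_eq_tsum, ← h1.tsum_add h2]
    exact tsum_congr e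
  obtain ⟨hx1, hx2, hx⟩ := hsplit x
  obtain ⟨hy1, hy2, hy'⟩ := hsplit y
  have hre := hK _ _ hx1 hy1 fun i => by
    rw [hy, jacobi_sub_apply]
    simp
  have him := hK _ _ hx2 hy2 fun i => by
    rw [hy, jacobi_sub_apply]
    simp
  refine le_of_sq_le_sq ?_ (by positivity)
  rw [mul_pow, Real.sq_sqrt hK0, hx, hy', mul_add]
  exact add_le_add hre him

theorem notMem_spectrum_of_sourceSink (χ : ℤ → Fin D) (lam : ℝ)
    (hhyp : ∀ d, IsHyperbolic (B.blockPropagation lam d))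
    (hss : SourceSinkCondition fun d => B.blockPropagation lam d) :
    (lam : ℂ) ∉ spectrum ℂ (B.jacobi χ) := by
  have : Nonempty (Fin D) := ⟨χ 0⟩
  obtain ⟨Q, hQ⟩ := hss.exists_quadraticForm (B.det_blockPropagation lam) hhyp
  exact B.notMem_spectrum_of_lyapunov χ lam hQ

end BlockLibrary

namespace BlockLibrary

variable {D : ℕ} (B : BlockLibrary D)

/-! ## Long windows of equal blocks -/

/-- The first slot of the `j`-th block of the array. -/
def firstSlot (χ : ℤ → Fin D) (j : ℤ) : B.Slot χ := ⟨j, ⟨0, B.len_pos _⟩⟩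

theorem slotShift_pow_firstSlot (χ : ℤ → Fin D) (j : ℤ) (r : ℕ) (hr : r < B.len (χ j)) :
    (B.slotShift χ ^ r) (B.firstSlot χ j) = ⟨j, ⟨r, hr⟩⟩ := by
  induction r with
  | zero => rfl
  | succ r ih =>
    rw [pow_succ', Equiv.Perm.mul_apply, ih (by omega)]
    exact dif_pos hr

theorem slotShift_pow_len_firstSlot (χ : ℤ → Fin D) (j : ℤ) :
    (B.slotShift χ ^ B.len (χ j)) (B.firstSlot χ j) = B.firstSlot χ (j + 1) := by
  have hpos := B.len_pos (χ j)
  obtain ⟨r, hr⟩ : ∃ r, B.len (χ j) = r + 1 := ⟨B.len (χ j) - 1, by omega⟩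
  rw [hr, pow_succ', Equiv.Perm.mul_apply, B.slotShift_pow_firstSlot χ j r (by omega)]
  exact dif_neg (hr ▸ lt_irrefl _ : ¬ r + 1 < B.len (χ j))

theorem slotAt_add (χ : ℤ → Fin D) (i : ℤ) (n : ℕ) :
    B.slotAt χ (i + n) = (B.slotShift χ ^ n) (B.slotAt χ i) := by
  rw [slotAt, add_comm, zpow_add, zpow_natCast]
  rfl

/-- Pseudo-ergodicity locates blocks, while the operator is indexed by resonators; this translates
one into the other. -/
theorem exists_slotAt_eq_firstSlot (χ : ℤ → Fin D) (j : ℤ) :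
    ∃ i, B.slotAt χ i = B.firstSlot χ j := by
  induction j using Int.induction_on with
  | zero => exact ⟨0, rfl⟩
  | succ j ih =>
    obtain ⟨i, hi⟩ := ih
    exact ⟨i + B.len (χ j), by rw [slotAt_add, hi, slotShift_pow_len_firstSlot]⟩
  | pred j ih =>
    obtain ⟨i, hi⟩ := ih
    refine ⟨i - B.len (χ (-j - 1)), ?_⟩
    apply (B.slotShift χ ^ B.len (χ (-j - 1))).injective
    rw [← slotAt_add, slotShift_pow_len_firstSlot, sub_add_cancel, sub_add_cancel, hi]

theorem slotAt_window {χ : ℤ → Fin D} {d : Fin D} {i j : ℤ} {n : ℕ}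
    (hi : B.slotAt χ i = B.firstSlot χ j) (hχ : ∀ k : ℕ, k < n → χ (j + k) = d) (k : ℕ)
    (hk : k ≤ n) : B.slotAt χ (i + (k * B.len d : ℕ)) = B.firstSlot χ (j + k) := by
  induction k with
  | zero => simpa using hi
  | succ k ih =>
    have h1 := B.slotShift_pow_len_firstSlot χ (j + k)
    rw [hχ k hk, ← ih (by omega), ← slotAt_add] at h1
    rw [Nat.cast_succ, ← add_assoc, ← h1]
    push_cast
    ring_nf

theorem resonator_congr {d d' : Fin D} (h : d = d') {r : ℕ} (hr : r < B.len d)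
    (hr' : r < B.len d') : B.resonator d ⟨r, hr⟩ = B.resonator d' ⟨r, hr'⟩ := by
  subst h
  rfl

theorem resonatorAt_window {χ : ℤ → Fin D} {d : Fin D} {i j : ℤ} {n : ℕ}
    (hi : B.slotAt χ i = B.firstSlot χ j) (hχ : ∀ k : ℕ, k < n → χ (j + k) = d) (t : ℕ)
    (ht : t < n * B.len d) :
    B.resonatorAt χ (i + t) = B.resonator d ⟨t % B.len d, Nat.mod_lt _ (B.len_pos d)⟩ := by
  have hk : t / B.len d < n := Nat.div_lt_of_lt_mul (by rwa [mul_comm])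
  have h1 := B.slotAt_window hi hχ (t / B.len d) hk.le
  have h2 := B.slotAt_add χ (i + (t / B.len d * B.len d : ℕ)) (t % B.len d)
  rw [add_assoc, ← Nat.cast_add, Nat.div_add_mod', h1] at h2
  have hd := hχ _ hk
  have hr : t % B.len d < B.len (χ (j + (t / B.len d : ℕ))) := by
    rw [hd]
    exact Nat.mod_lt _ (B.len_pos d)
  rw [B.slotShift_pow_firstSlot χ _ _ hr] at h2
  rw [resonatorAt, labelAt, h2, ofLabel]
  exact B.resonator_congr hd hr _

/-! ## Quasi-modes supported in a window -/

/-- A finitely supported sequence as an element of the Hilbert space. -/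
theorem exists_ellTwo_of_finite_support {f : ℤ → ℂ} (hf : {i | f i ≠ 0}.Finite) :
    ∃ x : EllTwo, ∀ i, x i = f i :=
  ⟨⟨f, (memℓp_zero hf).of_exponent_ge zero_le⟩, fun _ => rfl⟩

/-- A solution of the propagation equations in a window, cut off at its ends, solves the Jacobi
equation except at the ends of the window. -/
theorem jacobi_sub_apply_cutoff {χ : ℤ → Fin D} {lam : ℝ} {i₀ : ℤ} {T : ℕ} {u p : ℕ → ℂ}
    (hp : ∀ t < T, p (t + 1) = p t - ((B.resonatorAt χ (i₀ + t)).weight ^ 2)⁻¹ * lam * u t)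
    (hu : ∀ t < T, u (t + 1) = u t + (B.resonatorAt χ (i₀ + t)).spacing * p (t + 1))
    {x : EllTwo} (hx : ∀ t < T, x (i₀ + t) = ((B.resonatorAt χ (i₀ + t)).weight : ℂ)⁻¹ * u t)
    (hx₀ : ∀ i < i₀, x i = 0) (hx₁ : ∀ i, i₀ + T ≤ i → x i = 0)
    {i : ℤ} (h1 : i ≠ i₀ - 1) (h2 : i ≠ i₀) (h3 : i ≠ i₀ + T - 1) (h4 : i ≠ i₀ + T) :
    (B.jacobi χ - algebraMap ℂ (EllTwo →L[ℂ] EllTwo) lam) x i = 0 := by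
  rw [jacobi_sub_apply]
  rcases lt_or_ge i i₀ with hlt | hge
  · rw [hx₀ i hlt, hx₀ (i - 1) (by omega), hx₀ (i + 1) (by omega)]
    ring
  rcases lt_or_ge i (i₀ + T) with hlt' | hge'
  -- The excluded sites ensure that `i` and both its neighbours lie in the window, at the positions
  -- `t`, `t + 1`, `t + 2`.
  · obtain ⟨t, rfl⟩ : ∃ t : ℕ, i = i₀ + t + 1 := ⟨(i - i₀ - 1).toNat, by omega⟩
    have e1 : i₀ + (t : ℤ) + 1 = i₀ + (t + 1 : ℕ) := by push_cast; ring
    have e2 : i₀ + (t : ℤ) + 1 + 1 = i₀ + (t + 2 : ℕ) := by push_cast; ring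
    rw [add_sub_cancel_right, hx t (by omega), e2, hx (t + 2) (by omega), e1, hx (t + 1) (by omega)]
    simp only [offDiag_eq, diag_eq]
    rw [← e1, e2, add_sub_cancel_right, e1]
    have hp1 := hp (t + 1) (by omega)
    have hu0 := hu t (by omega)
    have hu1 := hu (t + 1) (by omega)
    have w0 := (B.resonatorAt χ (i₀ + t)).weight_pos.ne'
    have w1 := (B.resonatorAt χ (i₀ + (t + 1 : ℕ))).weight_pos.ne'
    have w2 := (B.resonatorAt χ (i₀ + (t + 2 : ℕ))).weight_pos.ne'
    have s0 := (B.resonatorAt χ (i₀ + t)).spacing_pos.ne'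
    have s1 := (B.resonatorAt χ (i₀ + (t + 1 : ℕ))).spacing_pos.ne'
    generalize (B.resonatorAt χ (i₀ + t)).weight = ω0 at *
    generalize (B.resonatorAt χ (i₀ + (t + 1 : ℕ))).weight = ω1 at *
    generalize (B.resonatorAt χ (i₀ + (t + 2 : ℕ))).weight = ω2 at *
    generalize (B.resonatorAt χ (i₀ + t)).spacing = σ0 at *
    generalize (B.resonatorAt χ (i₀ + (t + 1 : ℕ))).spacing = σ1 at *
    have w0' : (ω0 : ℂ) ≠ 0 := Complex.ofReal_ne_zero.mpr w0
    have w1' : (ω1 : ℂ) ≠ 0 := Complex.ofReal_ne_zero.mpr w1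
    have w2' : (ω2 : ℂ) ≠ 0 := Complex.ofReal_ne_zero.mpr w2
    have s0' : (σ0 : ℂ) ≠ 0 := Complex.ofReal_ne_zero.mpr s0
    have s1' : (σ1 : ℂ) ≠ 0 := Complex.ofReal_ne_zero.mpr s1
    have hu1' : u (t + 2) = u (t + 1) + σ1 * p (t + 1 + 1) := hu1
    rw [hu1', hp1, eq_sub_of_add_eq hu0.symm]
    push_cast
    field_simp
    ring
  · rw [hx₁ i hge', hx₁ (i - 1) (by omega), hx₁ (i + 1) (by omega)]
    ring

theorem norm_jacobi_sub_apply_le (χ : ℤ → Fin D) (lam : ℝ) :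
    ∃ C, 0 ≤ C ∧ ∀ (x : EllTwo) (M : ℝ), (∀ i, ‖x i‖ ≤ M) →
      ∀ i, ‖(B.jacobi χ - algebraMap ℂ (EllTwo →L[ℂ] EllTwo) lam) x i‖ ≤ C * M := by
  obtain ⟨a, ha⟩ := B.offDiag_bounded χ
  obtain ⟨b, hb⟩ := B.diag_bounded χ
  have ha0 := (abs_nonneg _).trans (ha 0)
  have hb0 := (abs_nonneg _).trans (hb 0)
  refine ⟨a + a + b + |lam|, by positivity, fun x M hM i => ?_⟩
  rw [jacobi_sub_apply]
  have key : ∀ (c C : ℝ) (j : ℤ), |c| ≤ C → ‖(c : ℂ) * x j‖ ≤ C * M := fun c C j h => by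
    rw [norm_mul, Complex.norm_real, Real.norm_eq_abs]
    exact mul_le_mul h (hM j) (norm_nonneg _) ((abs_nonneg _).trans h)
  refine (norm_sub_le _ _).trans ?_
  rw [add_mul, add_mul, add_mul]
  refine add_le_add (norm_add₃_le.trans ?_) (key _ _ _ le_rfl)
  exact add_le_add (add_le_add (key _ _ _ (ha _)) (key _ _ _ (ha _))) (key _ _ _ (hb _))

theorem sum_range_le_norm_sq (x : EllTwo) (i₀ : ℤ) (T : ℕ) :
    ∑ t ∈ Finset.range T, ‖x (i₀ + t)‖ ^ 2 ≤ ‖x‖ ^ 2 := by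
  rw [EllTwo.norm_sq_eq_tsum]
  have hinj : Function.Injective fun t : ℕ => i₀ + (t : ℤ) := fun a b h => by
    have h' : i₀ + (a : ℤ) = i₀ + b := h
    omega
  have := (EllTwo.summable_sq x).sum_le_tsum ((Finset.range T).map ⟨_, hinj⟩)
    (fun i _ => sq_nonneg _)
  rwa [Finset.sum_map] at this

/-- If there are arbitrarily long windows on which the propagation equations have a solution that
is bounded above and below, uniformly in the window, then the frequency lies in the spectrum. -/
theorem mem_spectrum_of_windows (χ : ℤ → Fin D) (lam : ℝ) {c C : ℝ} (hc : 0 < c)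
    (h : ∀ n : ℕ, ∃ (i₀ : ℤ) (T : ℕ) (u p : ℕ → ℂ), n ≤ T ∧
      (∀ t < T, p (t + 1) = p t - ((B.resonatorAt χ (i₀ + t)).weight ^ 2)⁻¹ * lam * u t) ∧
      (∀ t < T, u (t + 1) = u t + (B.resonatorAt χ (i₀ + t)).spacing * p (t + 1)) ∧
      (∀ t, ‖u t‖ ≤ C) ∧ ∀ t, c ≤ ‖u t‖ ^ 2 + ‖u (t + 1)‖ ^ 2) :
    (lam : ℂ) ∈ spectrum ℂ (B.jacobi χ) := by
  by_contra hcon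
  rw [spectrum.notMem_iff, IsUnit.sub_iff] at hcon
  obtain ⟨R, hR⟩ := hcon.exists_left_inv
  set J := B.jacobi χ - algebraMap ℂ (EllTwo →L[ℂ] EllTwo) lam with hJ
  have hRJ : ∀ x, ‖x‖ ≤ ‖R‖ * ‖J x‖ := fun x => by
    have h1 : R (J x) = x := congrArg (fun S : EllTwo →L[ℂ] EllTwo => S x) hR
    calc ‖x‖ = ‖R (J x)‖ := by rw [h1]
      _ ≤ _ := R.le_opNorm _
  obtain ⟨K, hK0, hK⟩ := B.norm_jacobi_sub_apply_le χ lam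
  obtain ⟨U, hU0, hU⟩ := B.exists_bound_of_label (fun p => (B.ofLabel p).weight) χ
  obtain ⟨U', hU'0, hU'⟩ := B.exists_bound_of_label (fun p => ((B.ofLabel p).weight)⁻¹) χ
  -- The residual has squared norm at most `4 * (K * (U' * C)) ^ 2`, whereas `‖x‖ ^ 2` is at least
  -- `n * c / (2 * U ^ 2)`. This `n` makes the two incompatible with the left inverse `R`.
  obtain ⟨n, hn⟩ := exists_nat_gt (‖R‖ ^ 2 * (4 * (K * (U' * C)) ^ 2) * (2 * U ^ 2) / c)
  obtain ⟨i₀, T, u, p, hnT, hp, hu, huC, hlow⟩ := h (n + 1)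
  have hC0 : 0 ≤ C := (norm_nonneg _).trans (huC 0)
  obtain ⟨x, hx⟩ := exists_ellTwo_of_finite_support
    (f := fun i => if i₀ ≤ i ∧ i < i₀ + T then
      ((B.resonatorAt χ i).weight : ℂ)⁻¹ * u (i - i₀).toNat else 0)
    ((Set.finite_Ico i₀ (i₀ + T)).subset fun i hi => by
      by_contra hcon
      exact hi (if_neg hcon))
  have hx_in : ∀ t < T, x (i₀ + t) = ((B.resonatorAt χ (i₀ + t)).weight : ℂ)⁻¹ * u t :=
    fun t ht => by
      rw [hx, if_pos ⟨by omega, by omega⟩, add_sub_cancel_left, Int.toNat_natCast]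
  have hx₀ : ∀ i < i₀, x i = 0 := fun i hi => by rw [hx, if_neg (by omega)]
  have hx₁ : ∀ i, i₀ + T ≤ i → x i = 0 := fun i hi => by rw [hx, if_neg (by omega)]
  have hxM : ∀ i, ‖x i‖ ≤ U' * C := fun i => by
    rw [hx]
    split_ifs
    · rw [norm_mul, norm_inv, Complex.norm_real, Real.norm_of_nonneg (Resonator.weight_pos _).le]
      exact mul_le_mul (hU' i) (huC _) (norm_nonneg _) hU'0.le
    · rw [norm_zero]
      positivity
  have hJx : ‖J x‖ ^ 2 ≤ 4 * (K * (U' * C)) ^ 2 := by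
    rw [EllTwo.norm_sq_eq_tsum, tsum_eq_sum (s := {i₀ - 1, i₀, i₀ + T - 1, i₀ + T})]
    · refine (Finset.sum_le_card_nsmul _ _ ((K * (U' * C)) ^ 2) fun i _ => ?_).trans ?_
      · exact pow_le_pow_left₀ (norm_nonneg _) (hK x _ hxM i) 2
      · rw [nsmul_eq_mul]
        gcongr
        exact_mod_cast Finset.card_le_four
    · intro i hi
      simp only [Finset.mem_insert, Finset.mem_singleton, not_or] at hi
      rw [hJ, B.jacobi_sub_apply_cutoff hp hu hx_in hx₀ hx₁ hi.1 hi.2.1 hi.2.2.1 hi.2.2.2]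
      simp
  have hsum : ∑ t ∈ Finset.range T, ‖u t‖ ^ 2 ≤ U ^ 2 * ‖x‖ ^ 2 := by
    refine le_trans ?_ (mul_le_mul_of_nonneg_left (sum_range_le_norm_sq x i₀ T) (sq_nonneg U))
    rw [Finset.mul_sum]
    refine Finset.sum_le_sum fun t ht => ?_
    have hw := (B.resonatorAt χ (i₀ + t)).weight_pos
    have e1 : u t = (B.resonatorAt χ (i₀ + t)).weight * x (i₀ + t) := by
      rw [hx_in t (Finset.mem_range.mp ht), mul_inv_cancel_left₀
        (Complex.ofReal_ne_zero.mpr hw.ne')]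
    rw [e1, norm_mul, Complex.norm_real, Real.norm_of_nonneg hw.le, mul_pow]
    have : (B.resonatorAt χ (i₀ + t)).weight ≤ U := hU (i₀ + t)
    gcongr
  -- The `n` consecutive pairs use `n + 1` sites, each at most twice; hence the window of length at
  -- least `n + 1`.
  have hsum' : n * c ≤ 2 * ∑ t ∈ Finset.range T, ‖u t‖ ^ 2 := by
    have h1 : ∑ t ∈ Finset.range (n + 1), ‖u t‖ ^ 2 ≤ ∑ t ∈ Finset.range T, ‖u t‖ ^ 2 :=
      Finset.sum_le_sum_of_subset_of_nonneg (Finset.range_mono hnT) fun _ _ _ => sq_nonneg _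
    have h2 := Finset.card_nsmul_le_sum (Finset.range n)
      (fun t => ‖u t‖ ^ 2 + ‖u (t + 1)‖ ^ 2) c fun t _ => hlow t
    rw [Finset.card_range, nsmul_eq_mul, Finset.sum_add_distrib] at h2
    have h3 := Finset.sum_range_succ (fun t => ‖u t‖ ^ 2) n
    have h4 := Finset.sum_range_succ' (fun t => ‖u t‖ ^ 2) n
    have h5 := sq_nonneg ‖u n‖
    have h6 := sq_nonneg ‖u 0‖
    linarith
  have hxn : ‖x‖ ^ 2 ≤ ‖R‖ ^ 2 * (4 * (K * (U' * C)) ^ 2) := by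
    calc ‖x‖ ^ 2 ≤ (‖R‖ * ‖J x‖) ^ 2 := pow_le_pow_left₀ (norm_nonneg _) (hRJ x) 2
      _ = ‖R‖ ^ 2 * ‖J x‖ ^ 2 := mul_pow _ _ _
      _ ≤ _ := by gcongr
  rw [div_lt_iff₀ hc] at hn
  have h7 : U ^ 2 * ‖x‖ ^ 2 ≤ U ^ 2 * (‖R‖ ^ 2 * (4 * (K * (U' * C)) ^ 2)) := by gcongr
  linarith

/-! ## Bloch solutions of a non-hyperbolic block -/

/-- The root is `(t + i √(4 - t ^ 2)) / 2`. The parabolic case `|t| = 2` is included, since a single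
eigenvector suffices for a Bloch solution. -/
theorem exists_unimodular_root {t : ℝ} (ht : |t| ≤ 2) :
    ∃ μ : ℂ, ‖μ‖ = 1 ∧ μ ^ 2 - t * μ + 1 = 0 := by
  have h4 : 0 ≤ 4 - t ^ 2 := by nlinarith [sq_abs t, abs_nonneg t]
  have hs := Real.sq_sqrt h4
  generalize √(4 - t ^ 2) = y at hs
  refine ⟨⟨t / 2, y / 2⟩, ?_, ?_⟩
  · rw [← sq_eq_sq₀ (norm_nonneg _) zero_le_one, ← Complex.normSq_eq_norm_sq, Complex.normSq_mk]
    nlinarith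
  · apply Complex.ext
    · simp [sq]
      nlinarith
    · simp [sq]
      ring

theorem mem_spectrum_of_abs_trace_le (χ : ℤ → Fin D) (hχ : IsPseudoErgodic χ) (lam : ℝ)
    {d : Fin D} (hd : |(B.blockPropagation lam d).trace| ≤ 2) :
    (lam : ℂ) ∈ spectrum ℂ (B.jacobi χ) := by
  obtain ⟨μ, hμ, hroot⟩ := exists_unimodular_root hd
  have hdet : ((B.blockPropagation lam d).map Complex.ofRealHom).det = 1 := by
    rw [← RingHom.mapMatrix_apply, ← RingHom.map_det, det_blockPropagation, map_one]
  obtain ⟨z, hz, hzμ⟩ := exists_eigenvector_of_root hdet (ξ := μ) (by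
    rw [← AddMonoidHom.map_trace]
    exact hroot)
  set L := B.len d with hL
  have hLpos : 0 < L := B.len_pos d
  set m : ℕ → Fin 2 → ℂ := fun r => (B.partialPropagation lam d r).map Complex.ofRealHom *ᵥ z
    with hm
  have hm0 : m 0 = z := by
    simp only [hm, partialPropagation_zero]
    rw [Matrix.map_one _ (map_zero _) (map_one _), Matrix.one_mulVec]
  have hmL : m L = μ • z := by
    simp only [hm, hL, partialPropagation_len]
    exact hzμ
  have hmsucc : ∀ r : Fin L, m (r + 1)
      = ((B.resonator d r).propagation lam).map Complex.ofRealHom *ᵥ m r := fun r => by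
    simp only [hm]
    rw [partialPropagation_succ, Matrix.map_mul, Matrix.mulVec_mulVec]
  have hmp : ∀ r : Fin L, m (r + 1) 1
      = m r 1 - ((B.resonator d r).weight ^ 2 : ℂ)⁻¹ * lam * m r 0 := fun r => by
    rw [hmsucc, Resonator.propagation, Resonator.length_div_speed_sq]
    simp [Matrix.mulVec, dotProduct, Fin.sum_univ_two]
    ring
  have hmu : ∀ r : Fin L, m (r + 1) 0
      = m r 0 + (B.resonator d r).spacing * m (r + 1) 1 := fun r => by
    rw [hmp, hmsucc, Resonator.propagation, Resonator.length_div_speed_sq]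
    simp [Matrix.mulVec, dotProduct, Fin.sum_univ_two]
    ring
  have hmne : ∀ r ≤ L, m r ≠ 0 := fun r hr h0 => by
    apply hz
    refine Matrix.eq_zero_of_mulVec_eq_zero ?_ h0
    rw [← RingHom.mapMatrix_apply, ← RingHom.map_det, B.det_partialPropagation lam d r hr, map_one]
    exact one_ne_zero
  -- The displacement may vanish at a single site. If it vanished at two neighbours, the flux
  -- between them would vanish too, and with it the whole state.
  have hpos : ∀ r : Fin L, 0 < ‖m r 0‖ ^ 2 + ‖m (r + 1) 0‖ ^ 2 := fun r => by
    by_contra hcon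
    have h0 : ‖m r 0‖ ^ 2 = 0 := by nlinarith [sq_nonneg ‖m r 0‖, sq_nonneg ‖m (r + 1) 0‖]
    have h1 : ‖m (r + 1) 0‖ ^ 2 = 0 := by nlinarith [sq_nonneg ‖m r 0‖, sq_nonneg ‖m (r + 1) 0‖]
    have h0' := norm_eq_zero.mp ((pow_eq_zero_iff two_ne_zero).mp h0)
    have h1' := norm_eq_zero.mp ((pow_eq_zero_iff two_ne_zero).mp h1)
    have h2 := hmu r
    rw [h0', h1', zero_add, eq_comm, mul_eq_zero, Complex.ofReal_eq_zero] at h2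
    have h3 := h2.resolve_left (B.resonator d r).spacing_pos.ne'
    apply hmne (r + 1) r.2
    funext i
    fin_cases i
    · exact h1'
    · exact h3
  have : Nonempty (Fin L) := ⟨⟨0, hLpos⟩⟩
  obtain ⟨rmin, hmin⟩ := Finite.exists_min fun r : Fin L => ‖m r 0‖ ^ 2 + ‖m (r + 1) 0‖ ^ 2
  obtain ⟨rmax, hmax⟩ := Finite.exists_max fun r : Fin L => ‖m r 0‖
  -- Quasi-periodic extension of the states in one block: since `μ` is unimodular, the bounds over
  -- one block hold for all `t`.
  set w : ℕ → Fin 2 → ℂ := fun t => μ ^ (t / L) • m (t % L) with hw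
  have hwsucc : ∀ t, w (t + 1) = μ ^ (t / L) • m (t % L + 1) := fun t => by
    have hdm := Nat.div_add_mod t L
    have hlt := Nat.mod_lt t hLpos
    rcases Nat.lt_or_ge (t % L + 1) L with h | h
    · have h4 : t + 1 = L * (t / L) + (t % L + 1) := by omega
      have h1 : (t + 1) / L = t / L := by
        conv_lhs => rw [h4]
        rw [Nat.mul_add_div hLpos, Nat.div_eq_of_lt h, add_zero]
      have h2 : (t + 1) % L = t % L + 1 := by
        conv_lhs => rw [h4]
        rw [Nat.mul_add_mod, Nat.mod_eq_of_lt h]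
      simp only [hw, h1, h2]
    · have h3 : t % L + 1 = L := by omega
      have h4 : t + 1 = L * (t / L + 1) := by rw [mul_add, mul_one]; omega
      simp only [hw]
      rw [h3, hmL, h4, Nat.mul_div_cancel_left _ hLpos, Nat.mul_mod_right, hm0, pow_succ, mul_smul]
  have hnorm : ∀ k : ℕ, ‖μ ^ k‖ = 1 := fun k => by rw [norm_pow, hμ, one_pow]
  refine B.mem_spectrum_of_windows χ lam (hpos rmin) (C := ‖m rmax 0‖) fun n => ?_
  obtain ⟨j, hj⟩ := hχ n fun _ => d
  obtain ⟨i₀, hi₀⟩ := B.exists_slotAt_eq_firstSlot χ j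
  have hres := B.resonatorAt_window hi₀ (n := n) fun k hk => hj ⟨k, hk⟩
  refine ⟨i₀, n * L, fun t => w t 0, fun t => w t 1, Nat.le_mul_of_pos_right n hLpos,
    fun t ht => ?_, fun t ht => ?_, fun t => ?_, fun t => ?_⟩
  · rw [hres t ht]
    simp only [hwsucc]
    simp only [hw, Pi.smul_apply, smul_eq_mul]
    rw [hmp ⟨t % L, Nat.mod_lt t hLpos⟩]
    push_cast
    ring
  · rw [hres t ht]
    simp only [hwsucc]
    simp only [hw, Pi.smul_apply, smul_eq_mul]
    rw [hmu ⟨t % L, Nat.mod_lt t hLpos⟩]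
    ring
  · simp only [hw, Pi.smul_apply, norm_smul, hnorm, one_mul]
    exact hmax ⟨t % L, Nat.mod_lt t hLpos⟩
  · simp only [hwsucc]
    simp only [hw, Pi.smul_apply, norm_smul, hnorm, one_mul]
    exact hmin ⟨t % L, Nat.mod_lt t hLpos⟩

end BlockLibrary

end BlockDisorder

theorem theorem3p12 {D : ℕ} (B : BlockDisorder.BlockLibrary D) (χ : ℤ → Fin D)
    (hχ : BlockDisorder.IsPseudoErgodic χ) (lam : ℝ) (hlam : 0 ≤ lam) :
    ((∀ d : Fin D, BlockDisorder.IsHyperbolic (B.blockPropagation lam d)) →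
      BlockDisorder.SourceSinkCondition (fun d : Fin D => B.blockPropagation lam d) →
      (lam : ℂ) ∉ spectrum ℂ (B.jacobi χ)) ∧
    ((∃ d : Fin D, |(B.blockPropagation lam d).trace| ≤ 2) →
      (lam : ℂ) ∈ spectrum ℂ (B.jacobi χ)) := by
  exact ⟨B.notMem_spectrum_of_sourceSink χ lam,
    fun ⟨_, hd⟩ => B.mem_spectrum_of_abs_trace_le χ hχ lam hd⟩
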